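/- **Notation.** For coprime integers $a,b$ with $b>0$ let $S(a,b)=12\sum_{k=1}^{b}\left(\left(\frac{k}{b}\right)\right)\left(\left(\frac{ak}{b}\right)\right)$ be the normalized Dedekind sum, where $((x))=\{x\}-\frac12$ for $x\notin\mathbb Z$ and $((x))=0$ for $x\in\mathbb Z$. For an integer $q\ge 2$ let $\Gamma_q\subseteq\mathbb Z/(q^2-1)\mathbb Z$ be $\{24s: s\in\mathbb Z/(q^2-1)\mathbb Z\}$ if $q$ is a perfect square and $\{12s: s\in\mathbb Z/(q^2-1)\mathbb Z\}$ otherwise. For integers $x,y$ with $\gcd(x,y)=\gcd(x^2+y^2,q)=1$ put $$h(x,y)=\frac{(q^2-1)xy^*}{x^2+y^2}-qS(qxy^*,x^2+y^2)\pmod{q^2-1},$$ where $y^*$ is any integer with $yy^*\equiv 1\pmod{x^2+y^2}$. Let $$\Lambda_q=\left\{\frac{(q^2-1)a}{t}-qS(aq,t)\pmod{q^2-1}\;:\;a,t\in\mathbb Z,\ t>0,\ t\mid a^2+1,\ \gcd(aq,t)=1\right\}.$$ **Theorem.** Let $q$ be an integer with $2\le q\le 200$. 1. The expressions reduced modulo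 $q^2-1$ in the definitions of $h(x,y)$ and $\Lambda_q$ are integers, and the class $h(x,y)$ does not depend on the choice of $y^*$. As $(x,y)$ ranges over all pairs of coprime integers with $\gcd(x^2+y^2,q)=1$, the set of values of $h(x,y)$ is exactly $\Gamma_q$. 2. $\Lambda_q=\Gamma_q$. 3. For every integer $k$ with $\gcd(k,q)=1$, there exist integers $a,b$ with $b\ge 1$, $\gcd(a,b)=1$ and $S(a,b)=\frac kq$ if and only if both of the following hold: - if $3\nmid q$, then $3\mid k$; - if $2\nmid q$, then $k\equiv 2\pmod 4$ when $q\equiv 3\pmod 4$; $k\equiv 0\pmod 8$ when $q$ is a perfect square; and $k\equiv 0\pmod 4$ in all other cases. -/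

import Mathlib

namespace DedekindRange

/-- The sawtooth function `((x))`: it is `{x} - 1/2` off the integers and `0` on the integers.
Dedekind sums only involve its values at rational numbers. -/
def sawtooth (x : ℚ) : ℚ :=
  if Int.fract x = 0 then 0 else Int.fract x - 1 / 2

/-- The Dedekind sum `s(a, b) = ∑_{k=1}^{b} ((k/b)) ((ak/b))`, for `b > 0`. -/
noncomputable def dedekindSum (a b : ℤ) : ℚ :=
  ∑ k ∈ Finset.Icc (1 : ℤ) b, sawtooth ((k : ℚ) / b) * sawtooth ((a * k : ℚ) / b)

/-- The normalized Dedekind sum `S(a, b) = 12 s(a, b)`. -/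
noncomputable def S (a b : ℤ) : ℚ := 12 * dedekindSum a b

/-- The rational number `r` is an integer whose residue class modulo `m` is `c`. -/
def ReducesTo (m : ℕ) (r : ℚ) (c : ZMod m) : Prop :=
  ∃ n : ℤ, (n : ℚ) = r ∧ (n : ZMod m) = c

/-- The rational number `(q² - 1) a / t - q S(aq, t)`. -/
noncomputable def lam (q : ℕ) (a t : ℤ) : ℚ :=
  ((q : ℚ) ^ 2 - 1) * a / t - q * S (a * q) t

/-- The pairs `(a, t)` over which `Λ_q` is formed: `t > 0`, `t ∣ a² + 1` and `gcd(aq, t) = 1`. -/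
def LamPair (q : ℕ) (a t : ℤ) : Prop :=
  0 < t ∧ t ∣ a ^ 2 + 1 ∧ IsCoprime (a * q) t

/-- The set `Λ_q ⊆ ℤ/(q² - 1)ℤ` of residues of `(q² - 1) a / t - q S(aq, t)`. -/
def LambdaSet (q : ℕ) : Set (ZMod (q ^ 2 - 1)) :=
  {c | ∃ a t : ℤ, LamPair q a t ∧ ReducesTo (q ^ 2 - 1) (lam q a t) c}

/-- The set `Γ_q ⊆ ℤ/(q² - 1)ℤ`: the multiples of `24` if `q` is a perfect square, and the
multiples of `12` otherwise. -/
def GammaSet (q : ℕ) : Set (ZMod (q ^ 2 - 1)) :=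
  {c | (IsSquare q ∧ ∃ s, c = 24 * s) ∨ (¬ IsSquare q ∧ ∃ s, c = 12 * s)}

/-- The pairs `(x, y)` on which `h` is defined: `gcd(x, y) = gcd(x² + y², q) = 1`. -/
def HPair (q : ℕ) (x y : ℤ) : Prop :=
  IsCoprime x y ∧ IsCoprime (x ^ 2 + y ^ 2) (q : ℤ)

/-- `h(x, y) = c`: for every inverse `y*` of `y` modulo `x² + y²`, the number
`(q² - 1) x y* / (x² + y²) - q S(q x y*, x² + y²)` is an integer and its class modulo `q² - 1`
is `c`. (Such inverses exist when `x` and `y` are coprime.) -/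
def HasH (q : ℕ) (x y : ℤ) (c : ZMod (q ^ 2 - 1)) : Prop :=
  ∀ y' : ℤ, y * y' ≡ 1 [ZMOD x ^ 2 + y ^ 2] →
    ReducesTo (q ^ 2 - 1)
      (((q : ℚ) ^ 2 - 1) * (x * y') / (x ^ 2 + y ^ 2) - q * S (q * x * y') (x ^ 2 + y ^ 2)) c

/-- The local conditions on the numerator `k` of a normalized Dedekind sum with reduced
denominator `q`. -/
def LocalConditions (k : ℤ) (q : ℕ) : Prop :=
  (¬ 3 ∣ q → (3 : ℤ) ∣ k) ∧
  (¬ 2 ∣ q →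
    (q ≡ 3 [MOD 4] → k ≡ 2 [ZMOD 4]) ∧
    (IsSquare q → k ≡ 0 [ZMOD 8]) ∧
    (¬ q ≡ 3 [MOD 4] → ¬ IsSquare q → k ≡ 0 [ZMOD 4]))

end DedekindRange

/-! Everything rests on Dedekind reciprocity and on the three-term relation `S_three_term` deduced
from it. Write λ(a, t) for `lam q a t`.

Upper bound. Reciprocity and induction determine b S(a, b) modulo 8 through the Jacobi symbol
(`numS_mod_eight`). Since S(a, t) = 0 when t ∣ a² + 1, it follows for odd q that 4 ∣ λ, and that 8 ∣
λ exactly when the symbol (t/q) is 1, which is automatic for square q. With 3 ∣ λ for 3 ∤ q this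
puts λ in Γ_q; factors 2 and 3 of q itself cost nothing, because q² = 1 modulo q² - 1.

Lower bound. h(x, y) is λ(a, x² + y²) with a ≡ x/y. Complete (x, y) to a matrix in SL₂(ℤ) and
multiply on the left by a matrix with first row (d, q). By the three-term relation
(`mul_lam_sub_lam`) the value drops by q · q²S(r, q²) modulo q² - 1, and r may be any integer prime
to q (`sub_mem_hValues`). A finite check finds r whose translations reach all multiples of 24 from
h(0, 1) = 0. For odd nonsquare q, a prime p = x² + y² modulo which q is a nonresidue yields a value
that is not divisible by 8 as an integer, and hence the other multiples of 12. Only these two finite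
checks use q ≤ 200.

Values k/q. By `mul_S_eq`, q S(A, qt) = q S(r, q) + λ(A, t') where t t' = A² + 1, so k/q is attained
once k - q S(k, q) lies in Λ_q; the local conditions put this class in Γ_q. Their necessity comes
from the congruences modulo 3 and 8, for every q ≥ 2. -/

namespace DedekindRange

/-! ### Sawtooth function and elementary symmetries of `S` -/

theorem sawtooth_add_int (x : ℚ) (n : ℤ) : sawtooth (x + n) = sawtooth x := by
  simp [sawtooth]

theorem sawtooth_neg (x : ℚ) : sawtooth (-x) = -sawtooth x := by
  unfold sawtooth
  by_cases h : Int.fract x = 0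
  · have h' : Int.fract (-x) = 0 := Int.fract_neg_eq_zero.2 h
    simp [h, h']
  · have h' : Int.fract (-x) ≠ 0 := fun h' => h (Int.fract_neg_eq_zero.1 h')
    rw [if_neg h, if_neg h', Int.fract_neg h]
    ring

theorem S_add_mul (a b j : ℤ) : S (a + b * j) b = S a b := by
  unfold S dedekindSum
  congr 1
  refine Finset.sum_congr rfl fun k hk => ?_
  have hb : (b : ℚ) ≠ 0 := by
    have := Finset.mem_Icc.1 hk
    exact_mod_cast (by omega : b ≠ 0)
  congr 1
  rw [← sawtooth_add_int ((a * k : ℚ) / b) (j * k)]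
  congr 1
  push_cast
  field_simp

theorem S_congr {a a' b : ℤ} (h : a ≡ a' [ZMOD b]) : S a b = S a' b := by
  obtain ⟨j, hj⟩ := h.dvd
  rw [show a' = a + b * j by linarith, S_add_mul]

theorem S_neg (a b : ℤ) : S (-a) b = -S a b := by
  unfold S dedekindSum
  rw [← mul_neg, ← Finset.sum_neg_distrib]
  congr 1
  refine Finset.sum_congr rfl fun k _ => ?_
  rw [← mul_neg, ← sawtooth_neg]
  congr 2
  push_cast
  ring

/-! ### Reciprocity law by counting with floor sums -/

theorem sum_range_mul_mod {M : Type*} [AddCommMonoid M] {h k : ℕ} (hk : 0 < k)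
    (hc : Nat.Coprime h k) (f : ℕ → M) :
    ∑ r ∈ Finset.range k, f (h * r % k) = ∑ r ∈ Finset.range k, f r := by
  have hinj : Set.InjOn (fun r => h * r % k) (Finset.range k : Set ℕ) := by
    intro x hx y hy hxy
    have h1 : h * x ≡ h * y [MOD k] := hxy
    have h2 := Nat.ModEq.cancel_left_of_coprime (by simpa [Nat.gcd_comm] using hc) h1
    have hx' : x < k := by simpa using hx
    have hy' : y < k := by simpa using hy
    exact Nat.ModEq.eq_of_lt_of_lt h2 hx' hy'
  have himg : (Finset.range k).image (fun r => h * r % k) = Finset.range k := by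
    apply Finset.eq_of_subset_of_card_le
    · intro x hx
      obtain ⟨r, _, rfl⟩ := Finset.mem_image.1 hx
      exact Finset.mem_range.2 (Nat.mod_lt _ hk)
    · rw [Finset.card_image_of_injOn hinj]
  conv_rhs => rw [← himg]
  rw [Finset.sum_image hinj]

theorem S_natCast_eq_sum_range {h k : ℕ} (hk : 0 < k) :
    S h k = 12 * ∑ r ∈ Finset.range k, sawtooth ((r : ℚ) / k) * sawtooth ((h * r : ℚ) / k) := by
  unfold S dedekindSum
  congr 1
  have hk0 : (k : ℚ) ≠ 0 := by positivity
  have h1 : ∑ i ∈ Finset.Icc (1 : ℤ) k, sawtooth ((i : ℚ) / (k : ℤ)) *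
      sawtooth ((((h : ℤ) : ℚ) * i) / (k : ℤ)) =
      ∑ r ∈ Finset.Icc 1 k, sawtooth ((r : ℚ) / k) * sawtooth ((h * r : ℚ) / k) := by
    symm
    refine Finset.sum_bij (fun r _ => (r : ℤ)) ?_ ?_ ?_ ?_
    · intro r hr
      simp only [Finset.mem_Icc] at hr ⊢
      omega
    · intro a _ b _ hab
      exact_mod_cast hab
    · intro b hb
      simp only [Finset.mem_Icc] at hb
      exact ⟨b.toNat, by simp only [Finset.mem_Icc]; omega, by omega⟩
    · intro r _
      simp
  rw [h1]
  have h0 : sawtooth 0 = 0 := by simp [sawtooth]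
  have hkk : sawtooth ((k : ℚ) / k) = 0 := by rw [div_self hk0]; simp [sawtooth]
  rw [Finset.range_eq_Ico, Finset.sum_eq_sum_Ico_succ_bot hk, ← Finset.Ico_insert_right hk,
    Finset.sum_insert (by simp)]
  simp [h0, hkk]

theorem sawtooth_natCast_div {m k : ℕ} (hk : 0 < k) :
    sawtooth ((m : ℚ) / k) = if m % k = 0 then 0 else ((m % k : ℕ) : ℚ) / k - 1 / 2 := by
  have hk0 : (k : ℚ) ≠ 0 := by positivity
  have h1 : Int.fract ((m : ℚ) / k) = ((m % k : ℕ) : ℚ) / k := by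
    have := Int.fract_div_intCast_eq_div_intCast_mod (k := ℚ) (m := m) (n := k)
    rw [← Int.natCast_mod, Int.cast_natCast, Int.cast_natCast] at this
    exact this
  unfold sawtooth
  rw [h1]
  by_cases h : m % k = 0
  · simp [h]
  · have : ((m % k : ℕ) : ℚ) / k ≠ 0 := div_ne_zero (by exact_mod_cast h) hk0
    rw [if_neg this, if_neg h]

theorem sum_range_cast (k : ℕ) : ∑ r ∈ Finset.range k, (r : ℚ) = k * (k - 1) / 2 := by
  induction k with
  | zero => simp
  | succ k ih => rw [Finset.sum_range_succ, ih]; push_cast; ring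

theorem sum_range_cast_sq (k : ℕ) :
    ∑ r ∈ Finset.range k, (r : ℚ) ^ 2 = k * (k - 1) * (2 * k - 1) / 6 := by
  induction k with
  | zero => simp
  | succ k ih => rw [Finset.sum_range_succ, ih]; push_cast; ring

theorem S_natCast_eq_sum_mod {h k : ℕ} (hk : 0 < k) (hc : Nat.Coprime h k) :
    (k : ℚ) ^ 2 * S h k =
      12 * ∑ r ∈ Finset.range k, (r : ℚ) * ((h * r % k : ℕ) : ℚ) - 3 * k ^ 2 * (k - 1) := by
  have hk0 : (k : ℚ) ≠ 0 := by positivity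
  rw [S_natCast_eq_sum_range hk]
  -- The term 1/4 corrects r = 0, where the sawtooth vanishes but the product of the two linear
  -- expressions is (-1/2)².
  have key : ∀ r ∈ Finset.range k, sawtooth ((r : ℚ) / k) * sawtooth ((h * r : ℚ) / k) =
      ((r : ℚ) / k - 1 / 2) * (((h * r % k : ℕ) : ℚ) / k - 1 / 2)
        - (if r = 0 then 1 / 4 else 0) := by
    intro r hr
    have hr' : r < k := Finset.mem_range.1 hr
    have e : (h * r : ℚ) / k = ((h * r : ℕ) : ℚ) / k := by push_cast; rfl
    rw [e, sawtooth_natCast_div hk, sawtooth_natCast_div hk, Nat.mod_eq_of_lt hr']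
    rcases Nat.eq_zero_or_pos r with rfl | hr0
    · simp; norm_num
    · have h2 : h * r % k ≠ 0 := by
        intro h3
        have h4 : k ∣ r := (Nat.Coprime.dvd_of_dvd_mul_left (Nat.coprime_comm.1 hc)
          (Nat.dvd_of_mod_eq_zero h3))
        exact absurd (Nat.le_of_dvd hr0 h4) (by omega)
      rw [if_neg hr0.ne', if_neg h2, if_neg hr0.ne']
      ring
  rw [Finset.sum_congr rfl key, Finset.sum_sub_distrib]
  have h3 : ∑ r ∈ Finset.range k, (if r = 0 then (1 / 4 : ℚ) else 0) = 1 / 4 := by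
    rw [Finset.sum_ite_eq' (Finset.range k) 0 (fun _ => (1 / 4 : ℚ))]
    simp [hk]
  have h4 := sum_range_mul_mod hk hc (fun r => (r : ℚ))
  rw [h3]
  have h5 : ∑ r ∈ Finset.range k, ((r : ℚ) / k - 1 / 2) * (((h * r % k : ℕ) : ℚ) / k - 1 / 2) =
      (∑ r ∈ Finset.range k, (r : ℚ) * ((h * r % k : ℕ) : ℚ)) / k ^ 2
      - (∑ r ∈ Finset.range k, (r : ℚ)) / (2 * k)
      - (∑ r ∈ Finset.range k, ((h * r % k : ℕ) : ℚ)) / (2 * k) + k / 4 := by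
    simp only [Finset.sum_div]
    rw [← Finset.sum_sub_distrib, ← Finset.sum_sub_distrib]
    have : (k : ℚ) / 4 = ∑ r ∈ Finset.range k, (1 / 4 : ℚ) := by simp; ring
    rw [this, ← Finset.sum_add_distrib]
    refine Finset.sum_congr rfl fun r _ => ?_
    field_simp
    ring
  rw [h5, h4, sum_range_cast]
  field_simp
  ring

/-- The sum `∑ r ⌊hr/k⌋` over `0 ≤ r < k`. -/
def floorSum (h k : ℕ) : ℕ := ∑ r ∈ Finset.range k, r * (h * r / k)

theorem mul_S_natCast {h k : ℕ} (hk : 0 < k) (hc : Nat.Coprime h k) :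
    (k : ℚ) * S h k =
      2 * h * (k - 1) * (2 * k - 1) - 12 * floorSum h k - 3 * k * (k - 1) := by
  have hk0 : (k : ℚ) ≠ 0 := by positivity
  have h1 := S_natCast_eq_sum_mod hk hc
  have h2 : ∑ r ∈ Finset.range k, (r : ℚ) * ((h * r % k : ℕ) : ℚ) =
      h * ∑ r ∈ Finset.range k, (r : ℚ) ^ 2 - k * floorSum h k := by
    unfold floorSum
    push_cast
    rw [Finset.mul_sum, Finset.mul_sum, ← Finset.sum_sub_distrib]
    refine Finset.sum_congr rfl fun r _ => ?_
    have : ((h * r % k : ℕ) : ℚ) + k * ((h * r / k : ℕ) : ℚ) = h * r := by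
      exact_mod_cast Nat.mod_add_div (h * r) k
    linear_combination (r : ℚ) * this
  rw [h2, sum_range_cast_sq] at h1
  apply mul_left_cancel₀ hk0
  linear_combination h1

/-- The residues of hr permute 0, …, k - 1, so expanding the squares of hr - k⌊hr/k⌋ must give back
the sum of r². -/
theorem sum_floor_sq {h k : ℕ} (hk : 0 < k) (hc : Nat.Coprime h k) :
    (k : ℚ) ^ 2 * ∑ r ∈ Finset.range k, ((h * r / k : ℕ) : ℚ) ^ 2 =
      2 * h * k * floorSum h k - (h ^ 2 - 1) * (k * (k - 1) * (2 * k - 1) / 6) := by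
  have h4 := sum_range_mul_mod hk hc (fun r => (r : ℚ) ^ 2)
  rw [← sum_range_cast_sq]
  have h5 : ∑ r ∈ Finset.range k, ((h * r % k : ℕ) : ℚ) ^ 2 =
      h ^ 2 * ∑ r ∈ Finset.range k, (r : ℚ) ^ 2 - 2 * h * k * floorSum h k +
      (k : ℚ) ^ 2 * ∑ r ∈ Finset.range k, ((h * r / k : ℕ) : ℚ) ^ 2 := by
    unfold floorSum
    push_cast
    simp only [Finset.mul_sum]
    rw [← Finset.sum_sub_distrib, ← Finset.sum_add_distrib]
    refine Finset.sum_congr rfl fun r _ => ?_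
    have : ((h * r % k : ℕ) : ℚ) = h * r - k * ((h * r / k : ℕ) : ℚ) := by
      have : ((h * r % k : ℕ) : ℚ) + k * ((h * r / k : ℕ) : ℚ) = h * r := by
        exact_mod_cast Nat.mod_add_div (h * r) k
      linarith
    rw [this]
    ring
  linear_combination h4 - h5

theorem sum_floor {h k : ℕ} (hk : 0 < k) (hc : Nat.Coprime h k) :
    ∑ r ∈ Finset.range k, ((h * r / k : ℕ) : ℚ) = (h - 1) * (k - 1) / 2 := by
  have hk0 : (k : ℚ) ≠ 0 := by positivity
  have h4 := sum_range_mul_mod hk hc (fun r => (r : ℚ))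
  have h5 : ∑ r ∈ Finset.range k, ((h * r % k : ℕ) : ℚ) =
      h * ∑ r ∈ Finset.range k, (r : ℚ) - k * ∑ r ∈ Finset.range k, ((h * r / k : ℕ) : ℚ) := by
    simp only [Finset.mul_sum]
    rw [← Finset.sum_sub_distrib]
    refine Finset.sum_congr rfl fun r _ => ?_
    have : ((h * r % k : ℕ) : ℚ) + k * ((h * r / k : ℕ) : ℚ) = h * r := by
      exact_mod_cast Nat.mod_add_div (h * r) k
    linarith
  rw [h4, sum_range_cast] at h5
  apply mul_left_cancel₀ hk0
  linear_combination h5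

theorem sq_eq_sum_range_ite {n m : ℕ} (h : n ≤ m) :
    (n : ℚ) ^ 2 = ∑ v ∈ Finset.range m, if v < n then (2 * v + 1 : ℚ) else 0 := by
  rw [← Finset.sum_filter]
  have : (Finset.range m).filter (· < n) = Finset.range n := by
    ext v; simp only [Finset.mem_filter, Finset.mem_range]; omega
  rw [this]
  clear this h
  induction n with
  | zero => simp
  | succ n ih => rw [Finset.sum_range_succ, ← ih]; push_cast; ring

/-- Each square is a sum of odd numbers 2v + 1. Exchanging the summations leaves, for each v, a
count of the r with ⌊hr/k⌋ > v, and this count is governed by ⌊k(v + 1)/h⌋. -/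
theorem sum_floor_sq_swap {h k : ℕ} (hh : 0 < h) (hk : 0 < k) (hc : Nat.Coprime h k) :
    ∑ r ∈ Finset.range k, ((h * r / k : ℕ) : ℚ) ^ 2 =
      (k - 1) * (h - 1) ^ 2 - 2 * floorSum k h + (h - 1) * (k - 1) / 2 := by
  have h1 : ∀ r ∈ Finset.range k, ((h * r / k : ℕ) : ℚ) ^ 2 =
      ∑ v ∈ Finset.range (h - 1), if v < h * r / k then (2 * v + 1 : ℚ) else 0 := by
    intro r hr
    apply sq_eq_sum_range_ite
    have : h * r / k < h := by
      rw [Nat.div_lt_iff_lt_mul hk]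
      exact Nat.mul_lt_mul_of_pos_left (Finset.mem_range.1 hr) hh
    omega
  rw [Finset.sum_congr rfl h1, Finset.sum_comm]
  have h2 : ∀ v ∈ Finset.range (h - 1),
      (∑ r ∈ Finset.range k, if v < h * r / k then (2 * v + 1 : ℚ) else 0) =
      (2 * v + 1) * (k - 1 - ((k * (v + 1) / h : ℕ) : ℚ)) := by
    intro v hv
    have hv' : v + 1 < h := by have := Finset.mem_range.1 hv; omega
    rw [← Finset.sum_filter, Finset.sum_const, nsmul_eq_mul, mul_comm]
    congr 1
    have hlt : k * (v + 1) / h < k := by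
      rw [Nat.div_lt_iff_lt_mul hh]
      exact Nat.mul_lt_mul_of_pos_left hv' hk
    have hset : (Finset.range k).filter (fun r => v < h * r / k) =
        Finset.Ico (k * (v + 1) / h + 1) k := by
      ext r
      simp only [Finset.mem_filter, Finset.mem_range, Finset.mem_Ico]
      have e1 : v < h * r / k ↔ (v + 1) * k ≤ h * r := by
        rw [← Nat.succ_le_iff, Nat.le_div_iff_mul_le hk]
      have e2 : k * (v + 1) / h + 1 ≤ r ↔ k * (v + 1) < r * h := by
        rw [Nat.succ_le_iff, Nat.div_lt_iff_lt_mul hh]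
      -- No lattice point lies on the line: by coprimality h would divide v + 1 < h. This makes the
      -- strict and weak inequalities agree.
      have e3 : k * (v + 1) ≠ r * h := by
        intro e
        have : h ∣ v + 1 := Nat.Coprime.dvd_of_dvd_mul_left hc ⟨r, by linarith⟩
        exact absurd (Nat.le_of_dvd (by omega) this) (by omega)
      rw [e1, e2]
      constructor
      · rintro ⟨a, b⟩
        exact ⟨lt_of_le_of_ne (by linarith) e3, a⟩
      · rintro ⟨a, b⟩
        exact ⟨b, by linarith⟩
    rw [hset, Nat.card_Ico, Nat.cast_sub hlt]
    push_cast
    ring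
  rw [Finset.sum_congr rfl h2]
  have h3 : ∀ g : ℕ → ℚ, g 0 = 0 →
      ∑ v ∈ Finset.range (h - 1), g (v + 1) = ∑ v ∈ Finset.range h, g v := by
    intro g hg
    conv_rhs => rw [show h = h - 1 + 1 by omega]
    rw [Finset.sum_range_succ', hg, add_zero]
  have h4 := sum_floor hh (Nat.coprime_comm.1 hc)
  have h5 : ∑ v ∈ Finset.range (h - 1), (2 * (v : ℚ) + 1) = (h - 1) ^ 2 := by
    have := sq_eq_sum_range_ite (le_refl (h - 1))
    rw [Nat.cast_sub hh] at this
    push_cast at this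
    rw [this]
    refine Finset.sum_congr rfl fun v hv => ?_
    rw [if_pos (Finset.mem_range.1 hv)]
  have h6 : ∑ v ∈ Finset.range (h - 1), (2 * (v : ℚ) + 1) * ((k * (v + 1) / h : ℕ) : ℚ) =
      2 * floorSum k h - (h - 1) * (k - 1) / 2 := by
    have e := h3 (fun v => (2 * (v : ℚ) - 1) * ((k * v / h : ℕ) : ℚ)) (by simp)
    have e' : ∑ v ∈ Finset.range h, (2 * (v : ℚ) - 1) * ((k * v / h : ℕ) : ℚ) =
        2 * floorSum k h - (k - 1) * (h - 1) / 2 := by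
      rw [← h4]
      unfold floorSum
      push_cast
      rw [Finset.mul_sum, ← Finset.sum_sub_distrib]
      refine Finset.sum_congr rfl fun v _ => ?_
      ring
    rw [e'] at e
    rw [mul_comm ((h : ℚ) - 1), ← e]
    refine Finset.sum_congr rfl fun v _ => ?_
    push_cast
    ring
  have h7 : ∑ v ∈ Finset.range (h - 1), (2 * (v : ℚ) + 1) *
      (k - 1 - ((k * (v + 1) / h : ℕ) : ℚ)) =
      (k - 1) * ∑ v ∈ Finset.range (h - 1), (2 * (v : ℚ) + 1) -
      ∑ v ∈ Finset.range (h - 1), (2 * (v : ℚ) + 1) * ((k * (v + 1) / h : ℕ) : ℚ) := by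
    rw [Finset.mul_sum, ← Finset.sum_sub_distrib]
    refine Finset.sum_congr rfl fun v _ => ?_
    ring
  rw [h7, h5, h6]
  ring

/-- The two evaluations of the sum of ⌊hr/k⌋², by residues and by lattice points, link `floorSum h
k` to `floorSum k h`. -/
theorem S_reciprocity_nat {h k : ℕ} (hh : 0 < h) (hk : 0 < k) (hc : Nat.Coprime h k) :
    S h k + S k h = -3 + ((h : ℚ) ^ 2 + k ^ 2 + 1) / (h * k) := by
  have hk0 : (k : ℚ) ≠ 0 := by positivity
  have hh0 : (h : ℚ) ≠ 0 := by positivity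
  have e1 := mul_S_natCast hk hc
  have e2 := mul_S_natCast hh (Nat.coprime_comm.1 hc)
  have e3 := sum_floor_sq hk hc
  have e4 := sum_floor_sq_swap hh hk hc
  rw [e4] at e3
  have e5 : (h : ℚ) * k * (S h k + S k h) = -3 * h * k + (h ^ 2 + k ^ 2 + 1) := by
    apply mul_left_cancel₀ hk0
    linear_combination (h : ℚ) * k * e1 + (k : ℚ) ^ 2 * e2 + 6 * e3
  field_simp
  linear_combination e5

/-- The reciprocity law for normalized Dedekind sums. -/
theorem S_reciprocity {a b : ℤ} (ha : 0 < a) (hb : 0 < b) (hc : IsCoprime a b) :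
    S a b + S b a = -3 + ((a : ℚ) ^ 2 + b ^ 2 + 1) / (a * b) := by
  lift a to ℕ using ha.le
  lift b to ℕ using hb.le
  have := S_reciprocity_nat (by exact_mod_cast ha) (by exact_mod_cast hb)
    (Nat.isCoprime_iff_coprime.1 hc)
  simpa using this

/-! ### The integer b S(a, b): integrality, divisibility by 3, residue modulo b -/

theorem exists_natCast_modEq (a : ℤ) {b : ℤ} (hb : 0 < b) (hc : IsCoprime a b) :
    ∃ h k : ℕ, (k : ℤ) = b ∧ 0 < k ∧ Nat.Coprime h k ∧ a ≡ h [ZMOD b] ∧ S a b = S h k := by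
  lift b to ℕ using hb.le
  have h0 : 0 ≤ a % b := Int.emod_nonneg _ hb.ne'
  have h1 : a ≡ ((a % b).toNat : ℤ) [ZMOD b] := by
    rw [Int.toNat_of_nonneg h0]
    exact (Int.mod_modEq a b).symm
  refine ⟨(a % b).toNat, b, rfl, by exact_mod_cast hb, ?_, h1, S_congr h1⟩
  rw [← Nat.isCoprime_iff_coprime, Int.toNat_of_nonneg h0]
  obtain ⟨u, v, huv⟩ := hc
  refine ⟨u, v + u * (a / b), ?_⟩
  have := Int.emod_add_mul_ediv a b
  linear_combination huv - (- u) * (this)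

/-- The integer `b S(a, b)`. -/
noncomputable def numS (a b : ℤ) : ℤ := ⌊(b : ℚ) * S a b⌋

theorem cast_numS {a b : ℤ} (hb : 0 < b) (hc : IsCoprime a b) :
    (numS a b : ℚ) = b * S a b := by
  obtain ⟨h, k, rfl, hk, hc', -, hS⟩ := exists_natCast_modEq a hb hc
  have := mul_S_natCast hk hc'
  have e : ((k : ℤ) : ℚ) * S a k =
    ((2 * h * (k - 1) * (2 * k - 1) - 12 * floorSum h k - 3 * k * (k - 1) : ℤ) : ℚ) := by
    rw [hS]
    push_cast
    exact this
  unfold numS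
  rw [e, Int.floor_intCast]

theorem numS_congr {a a' b : ℤ} (h : a ≡ a' [ZMOD b]) : numS a b = numS a' b := by
  unfold numS; rw [S_congr h]

theorem three_dvd_numS {a b : ℤ} (hb : 0 < b) (hc : IsCoprime a b) (h3 : ¬ 3 ∣ b) :
    3 ∣ numS a b := by
  have e0 := cast_numS hb hc
  obtain ⟨h, k, rfl, hk, hc', -, hS⟩ := exists_natCast_modEq a hb hc
  have := S_natCast_eq_sum_mod hk hc'
  have hP : ∑ r ∈ Finset.range k, (r : ℚ) * ((h * r % k : ℕ) : ℚ) =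
      ((∑ r ∈ Finset.range k, r * (h * r % k) : ℕ) : ℚ) := by push_cast; rfl
  rw [hP] at this
  generalize ∑ r ∈ Finset.range k, r * (h * r % k) = P at this
  have e1 : (k : ℤ) * numS a k = 3 * (4 * (P : ℤ) - k ^ 2 * (k - 1)) := by
    have : ((k * numS a k : ℤ) : ℚ) = ((3 * (4 * (P : ℤ) - k ^ 2 * (k - 1)) : ℤ) : ℚ) := by
      rw [Int.cast_mul, e0, hS]
      push_cast
      linear_combination this
    exact_mod_cast this
  exact (Int.prime_three.dvd_or_dvd ⟨_, e1⟩).resolve_left h3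

/-- Integral form of the reciprocity law. -/
theorem numS_reciprocity {a b : ℤ} (ha : 0 < a) (hb : 0 < b) (hc : IsCoprime a b) :
    a * numS a b + b * numS b a = -3 * a * b + a ^ 2 + b ^ 2 + 1 := by
  have h := S_reciprocity ha hb hc
  have e1 := cast_numS hb hc
  have e2 := cast_numS ha hc.symm
  have ha0 : (a : ℚ) ≠ 0 := by exact_mod_cast ha.ne'
  have hb0 : (b : ℚ) ≠ 0 := by exact_mod_cast hb.ne'
  have : ((a * numS a b + b * numS b a : ℤ) : ℚ) =
      ((-3 * a * b + a ^ 2 + b ^ 2 + 1 : ℤ) : ℚ) := by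
    push_cast
    rw [e1, e2]
    field_simp at h
    linear_combination h
  exact_mod_cast this

theorem exists_pos_modEq (a : ℤ) {b : ℤ} (hb : 0 < b) : ∃ a', 0 < a' ∧ a' ≡ a [ZMOD b] :=
  ⟨a % b + b, by have := Int.emod_nonneg a hb.ne'; omega, by simp [Int.ModEq]⟩

theorem IsCoprime.of_modEq {a a' b : ℤ} (h : a ≡ a' [ZMOD b]) (hc : IsCoprime a b) :
    IsCoprime a' b := by
  obtain ⟨j, hj⟩ := h.dvd
  rw [show a' = a + b * j by linarith]
  exact hc.add_mul_left_left j

/-- This is reciprocity reduced modulo b, for a positive representative of a. -/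
theorem mul_numS_modEq {a b : ℤ} (hb : 0 < b) (hc : IsCoprime a b) :
    a * numS a b ≡ a ^ 2 + 1 [ZMOD b] := by
  obtain ⟨a', ha', h⟩ := exists_pos_modEq a hb
  have hc' := IsCoprime.of_modEq h.symm hc
  have e := numS_reciprocity ha' hb hc'
  rw [← numS_congr h]
  have h1 : a' * numS a' b ≡ a' ^ 2 + 1 [ZMOD b] := by
    refine Int.ModEq.symm ((Int.modEq_iff_dvd).2 ⟨-3 * a' + b - numS b a', by linear_combination e⟩)
  exact ((h.symm.mul_right _).trans h1).trans ((h.pow 2).add_right 1)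

theorem S_one_right (a : ℤ) : S a 1 = 0 := by
  have h : a ≡ 0 [ZMOD 1] := Int.modEq_one
  rw [S_congr h]
  simp [S, dedekindSum, sawtooth]

/-! ### Vanishing at square roots of -1 -/

theorem sawtooth_congr {m m' : ℤ} {k : ℕ} (hk : 0 < k) (h : m ≡ m' [ZMOD k]) :
    sawtooth ((m : ℚ) / k) = sawtooth ((m' : ℚ) / k) := by
  obtain ⟨j, hj⟩ := h.dvd
  have hk0 : (k : ℚ) ≠ 0 := by positivity
  rw [show m' = m + k * j by linarith, ← sawtooth_add_int ((m : ℚ) / k) j]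
  congr 1
  push_cast
  field_simp

/-- The Dedekind sum vanishes at square roots of `-1`. -/
theorem S_eq_zero_of_dvd_sq_add_one {a t : ℤ} (ht : 0 < t) (h : t ∣ a ^ 2 + 1) : S a t = 0 := by
  have hc : IsCoprime a t := by
    obtain ⟨m, hm⟩ := h
    exact ⟨-a, m, by linear_combination -hm⟩
  obtain ⟨h', k, rfl, hk, hc', hm, hS⟩ := exists_natCast_modEq a ht hc
  have hsq : (h' : ℤ) ^ 2 ≡ -1 [ZMOD k] := by
    refine (hm.symm.pow 2).trans ?_
    exact (Int.modEq_iff_dvd.2 (by obtain ⟨m, hm⟩ := h; exact ⟨-m, by linear_combination -hm⟩))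
  rw [hS, S_natCast_eq_sum_range hk]
  set f : ℕ → ℚ := fun r => sawtooth ((r : ℚ) / k) * sawtooth ((h' * r : ℚ) / k) with hf
  have h1 := sum_range_mul_mod hk hc' f
  -- Replacing r by h'r swaps the two sawtooth factors up to a sign, since h'² ≡ -1. The permuted
  -- sum is therefore its own negative.
  have h2 : ∀ r ∈ Finset.range k, f (h' * r % k) = -f r := by
    intro r _
    have e0 : ((h' * r % k : ℕ) : ℤ) ≡ h' * r [ZMOD k] := by
      push_cast
      exact Int.mod_modEq _ _
    have e1 := sawtooth_congr hk e0
    have e2 : (h' : ℤ) * ((h' * r % k : ℕ) : ℤ) ≡ -r [ZMOD k] := by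
      refine (e0.mul_left _).trans ?_
      have := hsq.mul_right (r : ℤ)
      rw [show (h' : ℤ) * (h' * r) = (h' : ℤ) ^ 2 * r by ring]
      simpa using this
    have e3 := sawtooth_congr hk e2
    rw [Int.cast_mul, Int.cast_natCast, Int.cast_natCast] at e3
    rw [Int.cast_natCast, Int.cast_mul, Int.cast_natCast, Int.cast_natCast] at e1
    simp only [hf]
    rw [e1, e3, Int.cast_neg, Int.cast_natCast, neg_div, sawtooth_neg]
    ring
  rw [Finset.sum_congr rfl h2, Finset.sum_neg_distrib] at h1
  have : ∑ r ∈ Finset.range k, f r = 0 := by linarith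
  rw [this, mul_zero]

theorem numS_neg {a b : ℤ} (hb : 0 < b) (hc : IsCoprime a b) : numS (-a) b = -numS a b := by
  have h1 := cast_numS hb hc
  have h2 := cast_numS hb hc.neg_left
  rw [S_neg] at h2
  have : ((numS (-a) b : ℤ) : ℚ) = ((-numS a b : ℤ) : ℚ) := by
    push_cast
    linarith
  exact_mod_cast this

theorem numS_one_right (a : ℤ) : numS a 1 = 0 := by simp [numS, S_one_right]

/-! ### Dedekind sums modulo 8 and the Jacobi symbol -/

theorem jacobiSym_congr {a a' : ℤ} {n : ℕ} (h : a ≡ a' [ZMOD n]) :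
    jacobiSym a n = jacobiSym a' n := by
  rw [jacobiSym.mod_left a, jacobiSym.mod_left a', h]

theorem jacobiSym_eq_one_or {a : ℤ} {n : ℕ} (h : IsCoprime a n) :
    jacobiSym a n = 1 ∨ jacobiSym a n = -1 :=
  jacobiSym.eq_one_or_neg_one (Int.isCoprime_iff_gcd_eq_one.1 h)

theorem numS_mod_eight_neg {c : ℤ} {n : ℕ} (hn : Odd n) (hc : IsCoprime c n)
    (h : numS c n ≡ n + 1 - 2 * jacobiSym c n [ZMOD 8]) :
    numS (-c) n ≡ n + 1 - 2 * jacobiSym (-c) n [ZMOD 8] := by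
  have hn0 : (0 : ℤ) < n := by exact_mod_cast hn.pos
  rw [numS_neg hn0 hc, jacobiSym.neg c hn]
  unfold Int.ModEq at *
  obtain ⟨m, rfl⟩ := hn
  rcases Nat.even_or_odd' m with ⟨l, rfl | rfl⟩
  · rw [ZMod.χ₄_nat_one_mod_four (by omega)]
    rcases jacobiSym_eq_one_or hc with h' | h' <;> rw [h'] at h ⊢ <;> push_cast at h ⊢ <;> omega
  · rw [ZMod.χ₄_nat_three_mod_four (by omega)]
    rcases jacobiSym_eq_one_or hc with h' | h' <;> rw [h'] at h ⊢ <;> push_cast at h ⊢ <;> omega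

theorem sq_eq_one_zmod_eight : ∀ c m : ZMod 8, c = 2 * m + 1 → c * c = 1 := by decide

/-- The inductive step of `numS_mod_eight`: X, Y stand for the two values of `numS` and J, J' for
the two Jacobi symbols, with `hJ` encoding quadratic reciprocity. Odd squares are 1 modulo 8, so
multiplying by c solves for X; what remains is a check over the residues of c and n. -/
theorem reciprocity_mod_eight {c n : ℕ} (hco : Odd c) (hno : Odd n) {X Y J J' : ℤ}
    (h : (c : ℤ) * X + n * Y = -3 * c * n + c ^ 2 + n ^ 2 + 1)
    (hY : Y ≡ c + 1 - 2 * J' [ZMOD 8]) (hJ' : J' = 1 ∨ J' = -1)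
    (hJ : (c % 4 = 3 ∧ n % 4 = 3 → J = -J') ∧ (¬ (c % 4 = 3 ∧ n % 4 = 3) → J = J')) :
    X ≡ n + 1 - 2 * J [ZMOD 8] := by
  have hY' := (ZMod.intCast_eq_intCast_iff _ _ 8).2 hY
  have h' := congrArg (Int.cast : ℤ → ZMod 8) h
  refine (ZMod.intCast_eq_intCast_iff _ _ 8).1 ?_
  push_cast at hY' h' ⊢
  have hc2 : (c : ZMod 8) * c = 1 := by
    obtain ⟨m, rfl⟩ := hco
    exact sq_eq_one_zmod_eight _ m (by push_cast; rfl)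
  have hn2 : (n : ZMod 8) * n = 1 := by
    obtain ⟨m, rfl⟩ := hno
    exact sq_eq_one_zmod_eight _ m (by push_cast; rfl)
  have key : (-5 * (n : ZMod 8) + 3 * c - c * n + 2 * c * n * J' - 1 + 2 * J) = 0 := by
    have hc8 : c % 8 = 1 ∨ c % 8 = 3 ∨ c % 8 = 5 ∨ c % 8 = 7 := by
      have := Nat.odd_iff.1 hco; omega
    have hn8 : n % 8 = 1 ∨ n % 8 = 3 ∨ n % 8 = 5 ∨ n % 8 = 7 := by
      have := Nat.odd_iff.1 hno; omega
    have ec : (c : ZMod 8) = ((c % 8 : ℕ) : ZMod 8) := by simp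
    have en : (n : ZMod 8) = ((n % 8 : ℕ) : ZMod 8) := by simp
    by_cases h4 : c % 4 = 3 ∧ n % 4 = 3
    · have hJ1 := hJ.1 h4
      subst hJ1
      have hc8' : c % 8 = 3 ∨ c % 8 = 7 := by omega
      have hn8' : n % 8 = 3 ∨ n % 8 = 7 := by omega
      rw [ec, en]
      rcases hc8' with e | e <;> rcases hn8' with e' | e' <;> rcases hJ' with rfl | rfl <;>
        rw [e, e'] <;> decide
    · have hJ1 := hJ.2 h4
      subst hJ1
      rw [ec, en]
      rcases hc8 with e | e | e | e <;> rcases hn8 with e' | e' | e' | e' <;>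
        first
        | (exfalso; omega)
        | (rcases hJ' with rfl | rfl <;> rw [e, e'] <;> decide)
  linear_combination (c : ZMod 8) * h' - (X - c + 4 * n) * hc2 + c * hn2 - c * n * hY' + key

/-- The normalized Dedekind sum modulo `8` in terms of the Jacobi symbol. -/
theorem numS_mod_eight (n : ℕ) (hn : Odd n) (c : ℤ) (hc : IsCoprime c n) :
    numS c n ≡ n + 1 - 2 * jacobiSym c n [ZMOD 8] := by
  induction n using Nat.strong_induction_on generalizing c with
  | _ n ih =>
  have hn0 : (0 : ℤ) < n := by exact_mod_cast hn.pos
  rcases Nat.lt_or_ge 1 n with h1 | h1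
  swap
  · have : n = 1 := by have := hn.pos; omega
    subst this
    simp [numS_one_right]
  have main : ∀ c' : ℕ, Odd c' → c' < n → IsCoprime (c' : ℤ) n →
      numS c' n ≡ n + 1 - 2 * jacobiSym c' n [ZMOD 8] := by
    intro c' hodd hlt hcop
    have hY := ih c' hlt hodd n hcop.symm
    have hrec := numS_reciprocity (by exact_mod_cast hodd.pos) hn0 hcop
    refine reciprocity_mod_eight hodd hn hrec hY (jacobiSym_eq_one_or hcop.symm) ⟨?_, ?_⟩
    · rintro ⟨h3, h3'⟩
      exact jacobiSym.quadratic_reciprocity_three_mod_four h3 h3'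
    · intro h4
      have o1 := Nat.odd_iff.1 hodd
      have o2 := Nat.odd_iff.1 hn
      by_cases h5 : c' % 4 = 1
      · exact jacobiSym.quadratic_reciprocity_one_mod_four h5 hn
      · exact (jacobiSym.quadratic_reciprocity_one_mod_four (by omega) hodd).symm
  have h0 := Int.emod_nonneg c hn0.ne'
  have hlt := Int.emod_lt_of_pos c hn0
  have hmod : c ≡ c % n [ZMOD n] := (Int.mod_modEq c n).symm
  -- Reciprocity needs an odd positive argument below n. As n is odd, exactly one of c % n and n - c
  -- % n is odd; the second case costs a sign.
  rcases Int.even_or_odd (c % n) with he | ho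
  · have hodd : Odd (n - c % n) := by
      have : Odd (n : ℤ) := by exact_mod_cast hn
      exact this.sub_even he
    have hmod' : c ≡ -(n - c % n) [ZMOD n] := by
      refine hmod.trans (Int.modEq_iff_dvd.2 ⟨-1, by ring⟩)
    have hcop : IsCoprime (-(n - c % n)) (n : ℤ) := IsCoprime.of_modEq hmod' hc
    have hpos : c % n ≠ 0 := by
      intro h
      rw [h] at hmod
      have := IsCoprime.of_modEq hmod hc
      rw [isCoprime_zero_left, Int.isUnit_iff] at this
      omega
    rw [numS_congr hmod', jacobiSym_congr hmod']
    obtain ⟨m, hm⟩ := Int.eq_ofNat_of_zero_le (show 0 ≤ n - c % n by omega)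
    rw [hm] at hodd hcop ⊢
    have hcop' : IsCoprime (m : ℤ) n := by simpa using hcop.neg_left
    exact numS_mod_eight_neg hn hcop'
      (main m (by exact_mod_cast hodd) (by omega) hcop')
  · have hcop := IsCoprime.of_modEq hmod hc
    rw [numS_congr hmod, jacobiSym_congr hmod]
    obtain ⟨m, hm⟩ := Int.eq_ofNat_of_zero_le h0
    rw [hm] at ho hcop hlt ⊢
    exact main m (by exact_mod_cast ho) (by omega) hcop

/-! ### Three-term relation -/

/-- Euclidean descent on c: the rows (a, b), (c, d) become (c, d), (c', d') with c' = xc - a and d'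
= xd - b. This keeps the determinant B and the multiplier r, and reciprocity for (c', c) and (d', d)
accounts for the change. At c = 1 the claim is reciprocity for B and d. -/
theorem S_three_term_aux (N : ℕ) : ∀ {a b c d r B : ℤ}, c ≤ N → 0 < c → 0 < d → 0 < B →
    a * d - b * c = B → IsCoprime a c → IsCoprime b d → r * a ≡ b [ZMOD B] →
    r * c ≡ d [ZMOD B] →
    S b d = S a c + S r B + 3 - ((c : ℚ) ^ 2 + d ^ 2 + B ^ 2) / (c * d * B) := by
  induction N with
  | zero => intro a b c d r B h1 h2; exfalso; push_cast at h1; omega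
  | succ N ih =>
    intro a b c d r B hN hc hd hB hdet h1 h2 hr1 hr2
    have hd0 : (d : ℚ) ≠ 0 := by exact_mod_cast hd.ne'
    have hc0 : (c : ℚ) ≠ 0 := by exact_mod_cast hc.ne'
    have hB0 : (B : ℚ) ≠ 0 := by exact_mod_cast hB.ne'
    rcases eq_or_ne c 1 with rfl | hc1
    · have hb : b ≡ -B [ZMOD d] := Int.modEq_iff_dvd.2 ⟨-a, by linear_combination hdet⟩
      have hcop : IsCoprime B d := by simpa using (IsCoprime.of_modEq hb h2).neg_left
      rw [S_congr hb, S_neg, S_one_right, S_congr (show r ≡ d [ZMOD B] by simpa using hr2)]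
      have := S_reciprocity hB hd hcop
      have e : ((1 : ℤ) : ℚ) ^ 2 + (d : ℚ) ^ 2 + (B : ℚ) ^ 2 = (B : ℚ) ^ 2 + d ^ 2 + 1 := by
        push_cast; ring
      rw [e, show ((1 : ℤ) : ℚ) * d * B = B * d by push_cast; ring]
      linarith
    · obtain ⟨x, c', hx, hc'0, hc'1⟩ : ∃ x c' : ℤ, x * c - a = c' ∧ 0 ≤ c' ∧ c' < c :=
        ⟨-((-a) / c), (-a) % c, by have := Int.emod_add_mul_ediv (-a) c; linear_combination -this,
          Int.emod_nonneg _ hc.ne', Int.emod_lt_of_pos _ hc⟩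
      have hc'pos : 0 < c' := by
        refine lt_of_le_of_ne hc'0 fun h => ?_
        rw [← h] at hx
        have : IsCoprime (c * x) c := by rw [show c * x = a by linarith]; exact h1
        have := (IsCoprime.mul_left_iff.1 this).1
        rw [isCoprime_self, Int.isUnit_iff] at this
        omega
      obtain ⟨d', hd'⟩ : ∃ d', d' = x * d - b := ⟨_, rfl⟩
      have hdet' : c * d' - d * c' = B := by rw [hd', ← hx, ← hdet]; ring
      have hd'pos : 0 < d' := by
        have : 0 < c * d' := by
          have := mul_pos hd hc'pos
          linarith
        exact pos_of_mul_pos_right this hc.le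
      have ha' : a ≡ -c' [ZMOD c] := Int.modEq_iff_dvd.2 ⟨-x, by linear_combination hx⟩
      have hb' : b ≡ -d' [ZMOD d] := Int.modEq_iff_dvd.2 ⟨-x, by linear_combination -hd'⟩
      have hcop1 : IsCoprime c' c := by simpa using (IsCoprime.of_modEq ha' h1).neg_left
      have hcop2 : IsCoprime d' d := by simpa using (IsCoprime.of_modEq hb' h2).neg_left
      have hr3 : r * c' ≡ d' [ZMOD B] := by
        have := (hr2.mul_left x).sub hr1
        rw [← hx, hd']
        convert this using 1
        ring
      have key := ih (by push_cast at hN; omega) hc'pos hd'pos hB hdet' hcop1.symm hcop2.symm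
        hr2 hr3
      have k1 := S_reciprocity hc'pos hc hcop1
      have k2 := S_reciprocity hd'pos hd hcop2
      rw [S_congr ha', S_congr hb', S_neg, S_neg]
      have hd'0 : (d' : ℚ) ≠ 0 := by exact_mod_cast hd'pos.ne'
      have hc'0 : (c' : ℚ) ≠ 0 := by exact_mod_cast hc'pos.ne'
      have hBq : (B : ℚ) = c * d' - d * c' := by rw [← hdet']; push_cast; ring
      have alg : ((d' : ℚ) ^ 2 + d ^ 2 + 1) / (d' * d) =
          ((c' : ℚ) ^ 2 + c ^ 2 + 1) / (c' * c) - ((c' : ℚ) ^ 2 + d' ^ 2 + B ^ 2) / (c' * d' * B)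
          + ((c : ℚ) ^ 2 + d ^ 2 + B ^ 2) / (c * d * B) := by
        field_simp
        rw [hBq]
        ring
      linear_combination key + k1 - k2 - alg

/-- The three-term relation for normalized Dedekind sums. -/
theorem S_three_term {a b c d r B : ℤ} (hc : 0 < c) (hd : 0 < d) (hB : 0 < B)
    (hdet : a * d - b * c = B) (h1 : IsCoprime a c) (h2 : IsCoprime b d)
    (hr1 : r * a ≡ b [ZMOD B]) (hr2 : r * c ≡ d [ZMOD B]) :
    S b d = S a c + S r B + 3 - ((c : ℚ) ^ 2 + d ^ 2 + B ^ 2) / (c * d * B) :=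
  S_three_term_aux c.toNat (by omega) hc hd hB hdet h1 h2 hr1 hr2

/-! ### Integrality of λ and its residues modulo 3 and 8 -/

theorem lam_add_mul (q : ℕ) (a : ℤ) {t : ℤ} (ht : 0 < t) (j : ℤ) :
    lam q (a + t * j) t = lam q a t + ((q : ℚ) ^ 2 - 1) * j := by
  have ht0 : (t : ℚ) ≠ 0 := by exact_mod_cast ht.ne'
  unfold lam
  rw [show (a + t * j) * (q : ℤ) = a * q + t * (j * q) by ring, S_add_mul]
  push_cast
  field_simp
  ring

theorem lam_neg (q : ℕ) (a t : ℤ) : lam q (-a) t = -lam q a t := by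
  unfold lam
  rw [neg_mul, S_neg]
  push_cast
  ring

/-- The integer `(q² - 1) a / t - q S(aq, t)`. -/
noncomputable def numLam (q : ℕ) (a t : ℤ) : ℤ := ⌊lam q a t⌋

theorem LamPair.isCoprime {q : ℕ} {a t : ℤ} (h : LamPair q a t) :
    IsCoprime a t ∧ IsCoprime (q : ℤ) t := IsCoprime.mul_left_iff.1 h.2.2

theorem LamPair.exists_eq {q : ℕ} {a t : ℤ} (h : LamPair q a t) :
    ∃ n : ℤ, (n : ℚ) = lam q a t := by
  obtain ⟨ht, hd, hc⟩ := h
  have hca := (IsCoprime.mul_left_iff.1 hc).1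
  have ht0 : (t : ℚ) ≠ 0 := by exact_mod_cast ht.ne'
  have h1 := mul_numS_modEq ht hc
  -- Modulo t, aq · `numS (a * q) t` ≡ a²q² + 1, so the product is ≡ -(a² + 1) ≡ 0; then a is
  -- cancelled.
  have h2 : t ∣ a * (((q : ℤ) ^ 2 - 1) * a - q * numS (a * q) t) := by
    obtain ⟨m, hm⟩ := h1.dvd
    obtain ⟨l, hl⟩ := hd
    exact ⟨m - l, by linear_combination hm - hl⟩
  obtain ⟨n, hn⟩ := hca.symm.dvd_of_dvd_mul_left h2
  refine ⟨n, ?_⟩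
  unfold lam
  have h3 := cast_numS ht hc
  have h4 := congrArg (Int.cast : ℤ → ℚ) hn
  push_cast at h4
  field_simp
  rw [h3] at h4
  linear_combination -h4

theorem LamPair.cast_numLam {q : ℕ} {a t : ℤ} (h : LamPair q a t) :
    (numLam q a t : ℚ) = lam q a t := by
  obtain ⟨n, hn⟩ := h.exists_eq
  unfold numLam
  rw [← hn, Int.floor_intCast]

theorem LamPair.mul_numLam {q : ℕ} {a t : ℤ} (h : LamPair q a t) :
    t * numLam q a t = ((q : ℤ) ^ 2 - 1) * a - q * numS (a * q) t := by
  have h1 := h.cast_numLam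
  have h2 := cast_numS h.1 h.2.2
  have ht0 : (t : ℚ) ≠ 0 := by exact_mod_cast h.1.ne'
  have : ((t * numLam q a t : ℤ) : ℚ) =
      ((((q : ℤ) ^ 2 - 1) * a - q * numS (a * q) t : ℤ) : ℚ) := by
    push_cast
    rw [h1, h2]
    unfold lam
    field_simp
  exact_mod_cast this

theorem LamPair.add_mul {q : ℕ} {a t : ℤ} (h : LamPair q a t) (j : ℤ) :
    LamPair q (a + t * j) t ∧
      numLam q (a + t * j) t = numLam q a t + ((q : ℤ) ^ 2 - 1) * j := by
  have h' : LamPair q (a + t * j) t := by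
    obtain ⟨ht, hd, hc⟩ := h
    refine ⟨ht, ?_, ?_⟩
    · rw [show (a + t * j) ^ 2 + 1 = (a ^ 2 + 1) + t * (2 * a * j + t * j ^ 2) by ring]
      exact dvd_add hd (dvd_mul_right _ _)
    · rw [show (a + t * j) * (q : ℤ) = a * q + t * (j * q) by ring]
      exact hc.add_mul_left_left _
  refine ⟨h', ?_⟩
  have e1 := h.cast_numLam
  have e2 := h'.cast_numLam
  rw [lam_add_mul q a h.1 j, ← e1] at e2
  exact_mod_cast e2

theorem not_three_dvd_of_dvd_sq_add_one {a t : ℤ} (h : t ∣ a ^ 2 + 1) : ¬ (3 : ℤ) ∣ t := by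
  intro h3
  obtain ⟨m, hm⟩ := h3.trans h
  have : a % 3 = 0 ∨ a % 3 = 1 ∨ a % 3 = 2 := by omega
  obtain ⟨l, hl⟩ : ∃ l, l = a / 3 := ⟨_, rfl⟩
  rcases this with h | h | h
  · rw [show a = 3 * l by omega] at hm; ring_nf at hm; omega
  · rw [show a = 3 * l + 1 by omega] at hm; ring_nf at hm; omega
  · rw [show a = 3 * l + 2 by omega] at hm; ring_nf at hm; omega

theorem three_dvd_sq_sub_one {q : ℕ} (h : ¬ 3 ∣ q) : (3 : ℤ) ∣ (q : ℤ) ^ 2 - 1 := by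
  obtain ⟨l, rfl | rfl⟩ : ∃ l, q = 3 * l + 1 ∨ q = 3 * l + 2 := ⟨q / 3, by omega⟩
  · exact ⟨3 * l ^ 2 + 2 * l, by push_cast; ring⟩
  · exact ⟨3 * l ^ 2 + 4 * l + 1, by push_cast; ring⟩

theorem LamPair.three_dvd {q : ℕ} {a t : ℤ} (h : LamPair q a t) (hq : ¬ 3 ∣ q) :
    3 ∣ numLam q a t := by
  have h3 := not_three_dvd_of_dvd_sq_add_one h.2.1
  have h1 : (3 : ℤ) ∣ t * numLam q a t := by
    rw [h.mul_numLam]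
    exact dvd_sub ((three_dvd_sq_sub_one hq).mul_right _)
      ((three_dvd_numS h.1 h.2.2 h3).mul_left _)
  exact (Int.prime_three.dvd_or_dvd h1).resolve_left h3

theorem eight_dvd_sq_sub_one {q : ℤ} (h : Odd q) : 8 ∣ q ^ 2 - 1 :=
  Int.eight_dvd_sq_sub_one_of_odd h

/-- Because S(a, t) = 0, reciprocity gives `numS t a` = t + t' - 3a exactly. Comparing with
`numS_mod_eight` yields the congruence, as 4a ≡ 4 modulo 8. -/
theorem add_modEq_five_sub_jacobiSym {a : ℕ} (ha : Odd a) {t t' : ℤ} (ht : 0 < t)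
    (h : t * t' = (a : ℤ) ^ 2 + 1) : t + t' ≡ 5 - 2 * jacobiSym t a [ZMOD 8] := by
  have hc : IsCoprime (a : ℤ) t := ⟨-a, t', by linear_combination h⟩
  have ha0 : (0 : ℤ) < a := by exact_mod_cast ha.pos
  have h0 : numS a t = 0 := by
    simp [numS, S_eq_zero_of_dvd_sq_add_one ht ⟨t', h.symm⟩]
  have h1 := numS_reciprocity ha0 ht hc
  have h2 : numS t a = -3 * a + t + t' := by
    apply mul_left_cancel₀ ht.ne'
    rw [h0] at h1
    linear_combination h1 - h
  have h3 := numS_mod_eight a ha t hc.symm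
  rw [h2] at h3
  obtain ⟨m, rfl⟩ := ha
  unfold Int.ModEq at *
  push_cast at h3 ⊢
  omega

/-- Reciprocity for (aq, t) turns aλ into 3aq - (t + t') + `numS t (a * q)`. Both t + t' and the
last term are known modulo 8, and the symbol modulo aq factors. -/
theorem LamPair.mul_numLam_modEq_of_odd {q a : ℕ} {t : ℤ} (h : LamPair q a t) (hq : Odd q)
    (ha : Odd a) : a * numLam q a t ≡ 2 * jacobiSym t a * (1 - jacobiSym t q) [ZMOD 8] := by
  obtain ⟨t', ht'⟩ := h.2.1
  have ht := h.1
  have h5 := add_modEq_five_sub_jacobiSym ha ht ht'.symm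
  have ha0 : (0 : ℤ) < a * q := by exact_mod_cast Nat.mul_pos ha.pos hq.pos
  have h1 := numS_reciprocity ha0 ht h.2.2
  have h2 := h.mul_numLam
  have h3 : a * numLam q a t = -(t + t') + 3 * (a * q) + numS t (a * q) := by
    apply mul_left_cancel₀ ht.ne'
    linear_combination (a : ℤ) * h2 - h1 - ht'
  have hcop : IsCoprime t ((a * q : ℕ) : ℤ) := by push_cast; exact h.2.2.symm
  have h4 := numS_mod_eight (a * q) (ha.mul hq) t hcop
  have : NeZero a := ⟨ha.pos.ne'⟩
  have : NeZero q := ⟨hq.pos.ne'⟩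
  rw [jacobiSym.mul_right] at h4
  push_cast at h4
  rw [h3]
  obtain ⟨m, hm⟩ := ha.mul hq
  have hm' : (a : ℤ) * q = 2 * m + 1 := by exact_mod_cast hm
  rw [hm'] at h4 ⊢
  unfold Int.ModEq at *
  have hJ1 := jacobiSym_eq_one_or h.isCoprime.1.symm
  have hJ2 := jacobiSym_eq_one_or h.isCoprime.2.symm
  rcases hJ1 with e1 | e1 <;> rcases hJ2 with e2 | e2 <;> rw [e1] at h4 h5 ⊢ <;>
    rw [e2] at h4 ⊢ <;> omega

theorem exists_odd_pos_add_mul {a t : ℤ} (ht : 0 < t) (h : Even t → Odd a) :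
    ∃ j : ℤ, ∃ n : ℕ, (n : ℤ) = a + t * j ∧ Odd n := by
  have key : ∃ j : ℤ, 0 ≤ a + t * j ∧ Odd (a + t * j) := by
    have h1 : 0 ≤ a + t * (2 * |a|) := by
      nlinarith [abs_nonneg a, neg_abs_le a]
    rcases Int.even_or_odd t with ht2 | ht2
    · refine ⟨2 * |a|, h1, ?_⟩
      exact (h ht2).add_even (ht2.mul_right _)
    · rcases Int.even_or_odd a with ha | ha
      · refine ⟨2 * |a| + 1, by linarith, ?_⟩
        exact ha.add_odd (ht2.mul ⟨|a|, by ring⟩)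
      · exact ⟨2 * |a|, h1, ha.add_even (Even.mul_left ⟨|a|, by ring⟩ _)⟩
  obtain ⟨j, h0, ho⟩ := key
  obtain ⟨n, hn⟩ := Int.eq_ofNat_of_zero_le h0
  refine ⟨j, n, hn.symm, ?_⟩
  rw [hn] at ho
  exact_mod_cast ho

theorem odd_of_dvd_sq_add_one {a t : ℤ} (h : t ∣ a ^ 2 + 1) (ht : Even t) : Odd a := by
  by_contra ha
  rw [Int.not_odd_iff_even] at ha
  have : Even (a ^ 2 + 1) := even_iff_two_dvd.2 ((even_iff_two_dvd.1 ht).trans h)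
  have h2 : Odd (a ^ 2 + 1) := (ha.pow_of_ne_zero two_ne_zero).add_one
  exact Int.not_even_iff_odd.2 h2 this

theorem dvd_of_dvd_odd_mul {a x : ℤ} (k : ℕ) (ha : Odd a) (h : (2 : ℤ) ^ k ∣ a * x) :
    (2 : ℤ) ^ k ∣ x := by
  have : IsCoprime ((2 : ℤ) ^ k) a := by
    apply IsCoprime.pow_left
    obtain ⟨m, rfl⟩ := ha
    exact ⟨-m, 1, by ring⟩
  exact this.dvd_of_dvd_mul_left h

/-- For odd `q`, the integer `λ` is a multiple of `4`, and its class modulo `8` is determined by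
the Jacobi symbol of `t` modulo `q`. -/
theorem LamPair.numLam_mod_eight {q : ℕ} {a t : ℤ} (h : LamPair q a t) (hq : Odd q) :
    4 ∣ numLam q a t ∧ (8 ∣ numLam q a t ↔ jacobiSym t q = 1) := by
  -- Passing to an odd natural representative of a changes λ by a multiple of q² - 1, which is
  -- divisible by 8.
  obtain ⟨j, n, hn, hodd⟩ := exists_odd_pos_add_mul h.1 (odd_of_dvd_sq_add_one h.2.1)
  obtain ⟨h', e⟩ := h.add_mul j
  rw [← hn] at h' e
  have h1 := h'.mul_numLam_modEq_of_odd hq hodd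
  have h8 : (8 : ℤ) ∣ (q : ℤ) ^ 2 - 1 := eight_dvd_sq_sub_one (by exact_mod_cast hq)
  have hn' : Odd (n : ℤ) := by exact_mod_cast hodd
  have hred : (4 ∣ numLam q n t ∧ (8 ∣ numLam q n t ↔ jacobiSym t q = 1)) := by
    have hJ1 := jacobiSym_eq_one_or h'.isCoprime.1.symm
    have hJ2 := jacobiSym_eq_one_or h'.isCoprime.2.symm
    have d4 : (4 : ℤ) ∣ n * numLam q n t := by
      unfold Int.ModEq at h1
      rcases hJ1 with e1 | e1 <;> rcases hJ2 with e2 | e2 <;> rw [e1, e2] at h1 <;> omega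
    refine ⟨dvd_of_dvd_odd_mul 2 hn' d4, ?_, ?_⟩
    · intro h8'
      have h8'' : (8 : ℤ) ∣ n * numLam q n t := h8'.mul_left _
      unfold Int.ModEq at h1
      rcases hJ2 with e2 | e2
      · exact e2
      · exfalso
        rcases hJ1 with e1 | e1 <;> rw [e1, e2] at h1 <;> omega
    · intro e2
      apply dvd_of_dvd_odd_mul 3 hn'
      rw [e2] at h1
      exact Int.dvd_of_emod_eq_zero (by unfold Int.ModEq at h1; simpa using h1)
  rw [e] at hred
  have h8j : (8 : ℤ) ∣ ((q : ℤ) ^ 2 - 1) * j := h8.mul_right j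
  refine ⟨?_, ?_⟩
  · have := hred.1; omega
  · rw [← hred.2]; omega

/-! ### The inclusion of Λ_q in Γ_q -/

theorem jacobiSym_of_isSquare {q : ℕ} {t : ℤ} (hq : IsSquare q) (h0 : q ≠ 0)
    (hc : IsCoprime t q) : jacobiSym t q = 1 := by
  obtain ⟨m, rfl⟩ := hq
  have : NeZero m := ⟨by rintro rfl; simp at h0⟩
  push_cast at hc
  rw [jacobiSym.mul_right]
  rcases jacobiSym_eq_one_or (IsCoprime.mul_right_iff.1 hc).1 with e | e <;> rw [e] <;> rfl

theorem sq_cast_eq_one {q : ℕ} (hq : 2 ≤ q) : (q : ZMod (q ^ 2 - 1)) ^ 2 = 1 := by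
  have h := ZMod.natCast_self (q ^ 2 - 1)
  rw [Nat.cast_sub (Nat.one_le_pow _ _ (by omega))] at h
  push_cast at h
  exact sub_eq_zero.1 h

/-- Divisibility conditions that put the class of an integer into `Γ_q`. -/
theorem intCast_mem_GammaSet {q : ℕ} (hq : 2 ≤ q) {L : ℤ} (h3 : ¬ 3 ∣ q → 3 ∣ L)
    (h4 : Odd q → 4 ∣ L) (h8 : Odd q → IsSquare q → 8 ∣ L) :
    (L : ZMod (q ^ 2 - 1)) ∈ GammaSet q := by
  -- Since q² = 1 in this ring, the factor q⁶ does not change the class, yet it supplies a factor 3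
  -- when 3 ∣ q and a factor 8 when q is even.
  have e : (L : ZMod (q ^ 2 - 1)) = ((L * q ^ 6 : ℤ) : ZMod (q ^ 2 - 1)) := by
    push_cast
    rw [show (q : ZMod (q ^ 2 - 1)) ^ 6 = (q ^ 2) ^ 3 by ring, sq_cast_eq_one hq]
    simp
  have d3 : (3 : ℤ) ∣ L * q ^ 6 := by
    by_cases h : 3 ∣ q
    · have : (3 : ℤ) ∣ q := by exact_mod_cast h
      exact (this.pow (by norm_num : (6 : ℕ) ≠ 0)).mul_left _
    · exact (h3 h).mul_right _
  have d8 : Even q → (8 : ℤ) ∣ L * q ^ 6 := by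
    intro h
    obtain ⟨m, rfl⟩ := h
    exact ⟨L * 8 * m ^ 6, by push_cast; ring⟩
  have d4 : (4 : ℤ) ∣ L * q ^ 6 := by
    rcases Nat.even_or_odd q with h | h
    · have := d8 h; omega
    · exact (h4 h).mul_right _
  rw [e]
  by_cases hs : IsSquare q
  · left
    have : (8 : ℤ) ∣ L * q ^ 6 := by
      rcases Nat.even_or_odd q with h | h
      · exact d8 h
      · exact (h8 h hs).mul_right _
    obtain ⟨s, hs'⟩ : (24 : ℤ) ∣ L * q ^ 6 := by omega
    exact ⟨hs, s, by rw [hs']; push_cast; ring⟩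
  · right
    obtain ⟨s, hs'⟩ : (12 : ℤ) ∣ L * q ^ 6 := by omega
    exact ⟨hs, s, by rw [hs']; push_cast; ring⟩

theorem LamPair.numLam_mem_GammaSet {q : ℕ} (hq : 2 ≤ q) {a t : ℤ} (h : LamPair q a t) :
    (numLam q a t : ZMod (q ^ 2 - 1)) ∈ GammaSet q :=
  intCast_mem_GammaSet hq h.three_dvd (fun ho => (h.numLam_mod_eight ho).1)
    fun ho hs => ((h.numLam_mod_eight ho).2).2
      (jacobiSym_of_isSquare hs (by omega) h.isCoprime.2.symm)

theorem LambdaSet_subset_GammaSet {q : ℕ} (hq : 2 ≤ q) : LambdaSet q ⊆ GammaSet q := by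
  rintro c ⟨a, t, h, n, hn, rfl⟩
  have : n = numLam q a t := by
    have := h.cast_numLam
    rw [← hn] at this
    exact_mod_cast this.symm
  rw [this]
  exact h.numLam_mem_GammaSet hq

/-! ### Two consequences of the three-term relation for λ -/

/-- The three-term relation is applied to the rows (-A, -t') and (qt, Aq), of determinant q(tt' -
A²) = q. Reciprocity then turns S(t', Aq) into S(Aq, t'), which is the sum in λ(A, t'). -/
theorem mul_S_eq_of_pos {q : ℕ} {A t t' r : ℤ} (hq : 0 < q) (hA : 0 < A) (ht : 0 < t)
    (ht' : 0 < t') (h : t * t' = A ^ 2 + 1) (hcA : IsCoprime A (q : ℤ))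
    (hct : IsCoprime t' (q : ℤ)) (hr : r * A ≡ t' [ZMOD q]) :
    (q : ℚ) * S A (q * t) = q * S r q + lam q A t' := by
  have hq' : (0 : ℤ) < q := by exact_mod_cast hq
  have c1 : IsCoprime A t := ⟨-A, t', by linear_combination h⟩
  have c2 : IsCoprime A t' := ⟨-A, t, by linear_combination h⟩
  have h3 := S_three_term (a := -A) (b := -t') (c := q * t) (d := A * q) (r := r) (B := q)
    (by positivity) (by positivity) hq' (by linear_combination (q : ℤ) * h)
    (hcA.mul_right c1).neg_left (c2.symm.mul_right hct).neg_left
    (by have := hr.neg; rwa [← mul_neg] at this)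
    (Int.modEq_iff_dvd.2 ⟨A - r * t, by ring⟩)
  have h4 := S_reciprocity (a := A * q) (b := t') (by positivity) ht'
    (c2.symm.mul_right hct).symm
  rw [S_neg, S_neg] at h3
  unfold lam
  have hA0 : (A : ℚ) ≠ 0 := by exact_mod_cast hA.ne'
  have ht0 : (t : ℚ) ≠ 0 := by exact_mod_cast ht.ne'
  have ht0' : (t' : ℚ) ≠ 0 := by exact_mod_cast ht'.ne'
  have hq0 : (q : ℚ) ≠ 0 := by exact_mod_cast hq.ne'
  have hh : (t : ℚ) * t' = A ^ 2 + 1 := by exact_mod_cast h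
  have ht_eq : (t : ℚ) = (A ^ 2 + 1) / t' := by field_simp; exact hh
  have hpos : (A : ℚ) ^ 2 + 1 ≠ 0 := by positivity
  push_cast at h3 h4
  have alg : (q : ℚ) * (((A * q : ℚ) ^ 2 + t' ^ 2 + 1) / (A * q * t')) -
      q * (((q * t : ℚ) ^ 2 + (A * q) ^ 2 + q ^ 2) / (q * t * (A * q) * q)) =
      (q ^ 2 - 1) * A / t' := by
    rw [ht_eq]
    field_simp
    ring
  linear_combination (q : ℚ) * h3 + q * h4 + alg

theorem mul_S_eq {q : ℕ} {A t t' r : ℤ} (hq : 0 < q) (hA : A ≠ 0) (ht : 0 < t)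
    (ht' : 0 < t') (h : t * t' = A ^ 2 + 1) (hcA : IsCoprime A (q : ℤ))
    (hct : IsCoprime t' (q : ℤ)) (hr : r * A ≡ t' [ZMOD q]) :
    (q : ℚ) * S A (q * t) = q * S r q + lam q A t' := by
  rcases lt_or_gt_of_ne hA with hA' | hA'
  · have := mul_S_eq_of_pos (A := -A) (r := -r) hq (by omega) ht ht' (by rw [h]; ring)
      hcA.neg_left hct (by rwa [neg_mul_neg])
    rw [S_neg, S_neg, lam_neg] at this
    linear_combination -this
  · exact mul_S_eq_of_pos hq hA' ht ht' h hcA hct hr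

/-- Here t and T are the norms of the first row of a matrix in SL₂(ℤ) before and after left
multiplication by the matrix with rows (d, q), (b, e). The three-term relation for the rows (αq,
Xq), (t, s), of determinant q², links S(αq, t) to S(Xq, s) = -S(T, s). Reciprocity passes to S(s,
T), and s ≡ α'q modulo T. -/
theorem mul_lam_sub_lam {q : ℕ} {α t t' d e b r s X T α' : ℤ} (hq : 0 < q) (ht : 0 < t)
    (h : t * t' = α ^ 2 + 1) (hct : IsCoprime t (q : ℤ)) (hde : d * e - q * b = 1)
    (hs0 : s = d * t - q * α) (hX : X = d * α - q * t') (hT : T = d * s - q * X)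
    (hα' : α' = e * X - b * s) (hs : 0 < s) (hr : r * t ≡ s [ZMOD (q : ℤ) ^ 2]) :
    (q : ℚ) * (lam q α' T - lam q α t) =
      -((q : ℚ) ^ 2 - 1) * (d + e) - q ^ 2 * S r ((q : ℤ) ^ 2) := by
  have hq' : (0 : ℤ) < q := by exact_mod_cast hq
  have htT : t * T = s ^ 2 + (q : ℤ) ^ 2 := by
    rw [hT, hX, hs0]; linear_combination (q : ℤ) ^ 2 * h
  have hTpos : 0 < T := pos_of_mul_pos_right (by rw [htT]; positivity) ht.le
  have cαt : IsCoprime α t := ⟨-α, t', by linear_combination h⟩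
  have cdq : IsCoprime d (q : ℤ) := ⟨e, -b, by linear_combination hde⟩
  have csq : IsCoprime s (q : ℤ) := by
    have := (cdq.mul_left hct).add_mul_left_left (-α)
    rwa [show d * t + q * -α = s by rw [hs0]; ring] at this
  have hdet : α * q * s - X * q * t = (q : ℤ) ^ 2 := by
    rw [hs0, hX]; linear_combination (q : ℤ) ^ 2 * h
  have cX : IsCoprime (X * q) s := by
    have h1 : IsCoprime ((q : ℤ) ^ 2) s := csq.symm.pow_left
    have h2 := h1.add_mul_left_left (-(α * q))
    rw [show (q : ℤ) ^ 2 + s * -(α * q) = X * q * -t by linear_combination -hdet] at h2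
    exact h2.of_mul_left_left
  have hr1 : r ≡ d [ZMOD q] := by
    have h1 : t * r ≡ t * d [ZMOD q] := by
      have h2 : r * t ≡ s [ZMOD q] := hr.of_dvd (dvd_pow_self _ two_ne_zero)
      rw [mul_comm] at h2
      refine h2.trans (Int.modEq_iff_dvd.2 ⟨α, by rw [hs0]; ring⟩)
    obtain ⟨m, hm⟩ := h1.dvd
    exact Int.modEq_iff_dvd.2 (hct.symm.dvd_of_dvd_mul_left ⟨m, by linear_combination hm⟩)
  have hr2 : r * (α * q) ≡ X * q [ZMOD (q : ℤ) ^ 2] := by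
    obtain ⟨m, hm⟩ := hr1.dvd
    exact Int.modEq_iff_dvd.2 ⟨m * α - t', by rw [hX]; linear_combination α * q * hm⟩
  have h3 := S_three_term (a := α * q) (b := X * q) (c := t) (d := s) (r := r)
    (B := (q : ℤ) ^ 2) ht hs (by positivity) hdet (cαt.mul_left hct.symm) cX hr2 hr
  have hXT : X * q ≡ -T [ZMOD s] := Int.modEq_iff_dvd.2 ⟨-d, by rw [hT]; ring⟩
  have cT : IsCoprime T s := by simpa using (IsCoprime.of_modEq hXT cX).neg_left
  have hαq : α' * q = s - e * T := by
    rw [hα', hT]; linear_combination s * hde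
  have hαs : α' * q ≡ s [ZMOD T] := Int.modEq_iff_dvd.2 ⟨e, by rw [hαq]; ring⟩
  have h4 := S_reciprocity hs hTpos cT.symm
  rw [S_congr hXT, S_neg] at h3
  unfold lam
  rw [S_congr hαs]
  have hs' : (s : ℚ) ≠ 0 := by exact_mod_cast hs.ne'
  have ht0 : (t : ℚ) ≠ 0 := by exact_mod_cast ht.ne'
  have hT0 : (T : ℚ) ≠ 0 := by exact_mod_cast hTpos.ne'
  have hq0 : (q : ℚ) ≠ 0 := by exact_mod_cast hq.ne'
  have e1 : (α' : ℚ) = (s - e * T) / q := by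
    field_simp
    exact_mod_cast hαq
  have e2 : (α : ℚ) = (d * t - s) / q := by
    field_simp
    have : q * α = d * t - s := by rw [hs0]; ring
    exact_mod_cast (by rw [mul_comm]; exact this)
  have htT' : (t : ℚ) * T = s ^ 2 + q ^ 2 := by exact_mod_cast htT
  have e3 : (t : ℚ) = (s ^ 2 + q ^ 2) / T := by field_simp; exact htT'
  have hpos : (s : ℚ) ^ 2 + q ^ 2 ≠ 0 := by positivity
  push_cast at h3 h4
  have alg : (q : ℚ) * ((q ^ 2 - 1) * α' / T - (q ^ 2 - 1) * α / t) =
      -((q : ℚ) ^ 2 - 1) * (d + e) + q ^ 2 * ((s ^ 2 + T ^ 2 + 1) / (s * T))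
      - q ^ 2 * (((t : ℚ) ^ 2 + s ^ 2 + (q ^ 2) ^ 2) / (t * s * q ^ 2)) := by
    rw [e1, e2, e3]
    field_simp
    ring
  linear_combination alg - (q : ℚ) ^ 2 * h4 - q ^ 2 * h3

/-! ### The function h and the translations of its set of values -/

theorem HPair.norm_pos {q : ℕ} {x y : ℤ} (h : HPair q x y) : 0 < x ^ 2 + y ^ 2 := by
  rcases eq_or_ne x 0 with rfl | hx
  · have : y ≠ 0 := by
      rintro rfl
      exact not_isCoprime_zero_zero h.1
    positivity
  · positivity

theorem HPair.lamPair {q : ℕ} {x y a : ℤ} (h : HPair q x y)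
    (ha : y * a ≡ x [ZMOD x ^ 2 + y ^ 2]) : LamPair q a (x ^ 2 + y ^ 2) := by
  have hcy : IsCoprime (x ^ 2 + y ^ 2) (y ^ 2) := by
    have := (h.1.pow (m := 2) (n := 2)).add_mul_left_left 1
    rwa [mul_one] at this
  have hd : x ^ 2 + y ^ 2 ∣ a ^ 2 + 1 := by
    apply hcy.dvd_of_dvd_mul_left
    obtain ⟨m, hm⟩ := ha.dvd
    exact ⟨1 - m * (x + y * a), by linear_combination (-x - y * a) * hm⟩
  refine ⟨h.norm_pos, hd, ?_⟩
  obtain ⟨m, hm⟩ := hd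
  exact IsCoprime.mul_left ⟨-a, m, by linear_combination -hm⟩ h.2.symm

theorem HPair.lam_mul_eq {q : ℕ} {x y y' : ℤ} :
    ((q : ℚ) ^ 2 - 1) * (x * y') / (x ^ 2 + y ^ 2) - q * S (q * x * y') (x ^ 2 + y ^ 2) =
      lam q (x * y') (x ^ 2 + y ^ 2) := by
  unfold lam
  rw [show (q : ℤ) * x * y' = x * y' * q by ring]
  push_cast
  rfl

theorem HPair.hasH {q : ℕ} (hq : 2 ≤ q) {x y a : ℤ} (h : HPair q x y)
    (ha : y * a ≡ x [ZMOD x ^ 2 + y ^ 2]) :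
    HasH q x y (numLam q a (x ^ 2 + y ^ 2) : ZMod (q ^ 2 - 1)) := by
  intro y' hy'
  rw [HPair.lam_mul_eq]
  have h1 : a ≡ x * y' [ZMOD x ^ 2 + y ^ 2] := by
    have e1 := hy'.mul_left a
    have e2 := ha.mul_left y'
    rw [mul_one] at e1
    refine e1.symm.trans ?_
    rw [show a * (y * y') = y' * (y * a) by ring, mul_comm x]
    exact e2
  obtain ⟨j, hj⟩ := h1.dvd
  obtain ⟨p, e⟩ := (h.lamPair ha).add_mul j
  rw [← show x * y' = a + (x ^ 2 + y ^ 2) * j by linarith] at p e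
  refine ⟨_, p.cast_numLam, ?_⟩
  rw [e]
  push_cast
  rw [sq_cast_eq_one hq]
  ring

theorem HPair.exists_inv {q : ℕ} {x y : ℤ} (h : HPair q x y) :
    ∃ y', y * y' ≡ 1 [ZMOD x ^ 2 + y ^ 2] := by
  obtain ⟨u, v, huv⟩ : IsCoprime y (x ^ 2 + y ^ 2) := by
    have := (h.1.symm.pow_right (n := 2)).add_mul_left_right y
    rwa [← sq] at this
  exact ⟨u, Int.modEq_iff_dvd.2 ⟨v, by linear_combination -huv⟩⟩

theorem HasH.unique {q : ℕ} {x y : ℤ} (h : HPair q x y) {c c' : ZMod (q ^ 2 - 1)}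
    (hc : HasH q x y c) (hc' : HasH q x y c') : c = c' := by
  obtain ⟨y', hy'⟩ := h.exists_inv
  obtain ⟨n, hn, rfl⟩ := hc y' hy'
  obtain ⟨n', hn', rfl⟩ := hc' y' hy'
  have : n = n' := by exact_mod_cast hn.trans hn'.symm
  rw [this]

theorem HPair.existsUnique_hasH {q : ℕ} (hq : 2 ≤ q) {x y : ℤ} (h : HPair q x y) :
    ∃! c, HasH q x y c := by
  obtain ⟨y', hy'⟩ := h.exists_inv
  have ha : y * (x * y') ≡ x [ZMOD x ^ 2 + y ^ 2] := by
    have := hy'.mul_left x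
    rwa [mul_one, ← mul_assoc, mul_comm x, mul_assoc] at this
  exact ⟨_, h.hasH hq ha, fun c hc => HasH.unique h hc (h.hasH hq ha)⟩

/-- The set of values of `h`. -/
def hValues (q : ℕ) : Set (ZMod (q ^ 2 - 1)) := {c | ∃ x y : ℤ, HPair q x y ∧ HasH q x y c}

theorem hValues_subset_LambdaSet {q : ℕ} : hValues q ⊆ LambdaSet q := by
  rintro c ⟨x, y, h, hc⟩
  obtain ⟨y', hy'⟩ := h.exists_inv
  have ha : y * (x * y') ≡ x [ZMOD x ^ 2 + y ^ 2] := by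
    have := hy'.mul_left x
    rwa [mul_one, ← mul_assoc, mul_comm x, mul_assoc] at this
  refine ⟨x * y', x ^ 2 + y ^ 2, h.lamPair ha, ?_⟩
  rw [← HPair.lam_mul_eq]
  exact hc y' hy'

theorem zero_mem_hValues {q : ℕ} (hq : 2 ≤ q) : (0 : ZMod (q ^ 2 - 1)) ∈ hValues q := by
  have h : HPair q 0 1 := ⟨isCoprime_one_right, by simpa using isCoprime_one_left⟩
  refine ⟨0, 1, h, ?_⟩
  have := h.hasH hq (a := 0) (by simp)
  have e : numLam q 0 (0 ^ 2 + 1 ^ 2) = 0 := by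
    simp [numLam, lam, S_one_right]
  rwa [e, Int.cast_zero] at this

theorem exists_pos_sub_of_modEq {m t r : ℤ} (hm : 0 < m) (ht : 0 < t) (k : ℤ) :
    ∃ d, d ≡ r [ZMOD m] ∧ 0 < d * t - k := by
  refine ⟨r + m * (|r| + |k| + 1), Int.modEq_iff_dvd.2 ⟨-(|r| + |k| + 1), by ring⟩, ?_⟩
  have h1 : |k| + 1 ≤ r + m * (|r| + |k| + 1) := by
    nlinarith [neg_abs_le r, abs_nonneg r, abs_nonneg k]
  have h2 := le_abs_self k
  nlinarith [abs_nonneg k]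

/-- The values of `h` are closed under subtraction of the numbers `q³ S(r, q²)`. -/
theorem sub_mem_hValues {q : ℕ} (hq : 2 ≤ q) {c : ZMod (q ^ 2 - 1)} (hc : c ∈ hValues q) {r : ℤ}
    (hr : IsCoprime r (q : ℤ)) :
    c - q * (numS r ((q : ℤ) ^ 2) : ZMod (q ^ 2 - 1)) ∈ hValues q := by
  obtain ⟨x, y, h, hc⟩ := hc
  obtain ⟨v, u', huv⟩ := h.1
  obtain ⟨u, rfl⟩ : ∃ u, u' = -u := ⟨-u', by ring⟩
  have hdet : x * v - y * u = 1 := by linear_combination huv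
  obtain ⟨t, ht⟩ : ∃ t, t = x ^ 2 + y ^ 2 := ⟨_, rfl⟩
  -- With (u, v) completing (x, y) to determinant 1, this α represents x/y modulo t and satisfies
  -- t(u² + v²) = α² + 1.
  obtain ⟨α, hα⟩ : ∃ α, α = -(x * u + y * v) := ⟨_, rfl⟩
  have htpos : 0 < t := ht ▸ h.norm_pos
  have htt' : t * (u ^ 2 + v ^ 2) = α ^ 2 + 1 := by
    rw [ht, hα]; linear_combination (x * v - y * u + 1) * hdet
  have hαy : y * α ≡ x [ZMOD x ^ 2 + y ^ 2] :=
    Int.modEq_iff_dvd.2 ⟨v, by rw [hα]; linear_combination -x * hdet⟩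
  have hct : IsCoprime t (q : ℤ) := ht ▸ h.2
  have hq0 : (0 : ℤ) < q := by exact_mod_cast (by omega : 0 < q)
  obtain ⟨t₁, m, htm⟩ : IsCoprime t ((q : ℤ) ^ 2) := hct.pow_right
  -- As t₁ inverts t modulo q², this class of d gives dt - qα ≡ rt modulo q². It also gives d ≡ r
  -- modulo q, so (d, q) extends to a matrix of determinant 1.
  obtain ⟨d, hd, hs⟩ := exists_pos_sub_of_modEq (m := (q : ℤ) ^ 2) (r := r + q * α * t₁)
    (by positivity) htpos (q * α)
  have hdr : d ≡ r [ZMOD q] := by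
    have := hd.of_dvd (dvd_pow_self (q : ℤ) two_ne_zero)
    exact this.trans (Int.modEq_iff_dvd.2 ⟨-(α * t₁), by ring⟩)
  have hcd : IsCoprime d (q : ℤ) := IsCoprime.of_modEq hdr.symm hr
  obtain ⟨e, b', heb⟩ := hcd
  obtain ⟨b, rfl⟩ : ∃ b, b' = -b := ⟨-b', by ring⟩
  have hde : d * e - q * b = 1 := by linear_combination heb
  have hrt : r * t ≡ d * t - q * α [ZMOD (q : ℤ) ^ 2] := by
    obtain ⟨l, hl⟩ := hd.symm.dvd
    exact Int.modEq_iff_dvd.2 ⟨l * t - q * α * m, by linear_combination t * hl + q * α * htm⟩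
  obtain ⟨X, hX⟩ : ∃ X, X = d * α - q * (u ^ 2 + v ^ 2) := ⟨_, rfl⟩
  have key := mul_lam_sub_lam (by omega) htpos htt' hct hde rfl hX rfl rfl hs hrt
  obtain ⟨x₁, hx₁⟩ : ∃ x₁, x₁ = d * x + q * u := ⟨_, rfl⟩
  obtain ⟨y₁, hy₁⟩ : ∃ y₁, y₁ = d * y + q * v := ⟨_, rfl⟩
  have hT : d * (d * t - q * α) - q * X = x₁ ^ 2 + y₁ ^ 2 := by
    rw [hX, hα, ht, hx₁, hy₁]; ring
  have hdet₁ : x₁ * (b * y + e * v) - y₁ * (b * x + e * u) = 1 := by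
    rw [hx₁, hy₁]; linear_combination (d * e - q * b) * hdet + hde
  have hα₁ : e * X - b * (d * t - q * α) =
      -(x₁ * (b * x + e * u) + y₁ * (b * y + e * v)) := by
    rw [hX, hα, ht, hx₁, hy₁]
    linear_combination (-(x * u + y * v)) * (d * e + q * b - d * e - q * b) * hdet
  rw [hT, hα₁] at key
  have h₁ : HPair q x₁ y₁ := by
    refine ⟨⟨b * y + e * v, -(b * x + e * u), by linear_combination hdet₁⟩, ?_⟩
    have := ((IsCoprime.of_modEq hdr.symm hr).mul_left ((IsCoprime.of_modEq hdr.symm hr).mul_left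
      hct)).add_mul_left_left (-(2 * d * α) + q * (u ^ 2 + v ^ 2))
    rwa [show d * (d * t) + q * (-(2 * d * α) + q * (u ^ 2 + v ^ 2)) = x₁ ^ 2 + y₁ ^ 2 by
      rw [← hT, hX]; ring] at this
  obtain ⟨α₁, hα₁'⟩ : ∃ α₁, α₁ = -(x₁ * (b * x + e * u) + y₁ * (b * y + e * v)) := ⟨_, rfl⟩
  have hαy₁ : y₁ * α₁ ≡ x₁ [ZMOD x₁ ^ 2 + y₁ ^ 2] :=
    Int.modEq_iff_dvd.2 ⟨b * y + e * v, by rw [hα₁']; linear_combination -x₁ * hdet₁⟩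
  refine ⟨x₁, y₁, h₁, ?_⟩
  convert h₁.hasH hq hαy₁ using 1
  rw [HasH.unique h hc (h.hasH hq hαy)]
  rw [← hα₁', ht, ← (h₁.lamPair hαy₁).cast_numLam, ← (h.lamPair hαy).cast_numLam] at key
  have hS := cast_numS (show (0 : ℤ) < (q : ℤ) ^ 2 by positivity) (hr.pow_right (n := 2))
  have key2 : (q : ℤ) * (numLam q α₁ (x₁ ^ 2 + y₁ ^ 2) - numLam q α (x ^ 2 + y ^ 2)) =
      -((q : ℤ) ^ 2 - 1) * (d + e) - numS r ((q : ℤ) ^ 2) := by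
    have : (((q : ℤ) * (numLam q α₁ (x₁ ^ 2 + y₁ ^ 2) - numLam q α (x ^ 2 + y ^ 2)) : ℤ) : ℚ) =
      ((-((q : ℤ) ^ 2 - 1) * (d + e) - numS r ((q : ℤ) ^ 2) : ℤ) : ℚ) := by
      push_cast at hS ⊢
      rw [key, hS]
    exact_mod_cast this
  have key3 := congrArg (Int.cast : ℤ → ZMod (q ^ 2 - 1)) key2
  push_cast at key3
  have hq1 := sq_cast_eq_one hq
  -- Multiplying by q isolates the difference of the two values, since q² = 1.
  linear_combination (-(q : ZMod (q ^ 2 - 1))) * key3 +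
    ((numLam q α₁ (x₁ ^ 2 + y₁ ^ 2) : ZMod (q ^ 2 - 1)) - numLam q α (x ^ 2 + y ^ 2)
      + q * (d + e)) * hq1

theorem sub_nsmul_mem_hValues {q : ℕ} (hq : 2 ≤ q) {c : ZMod (q ^ 2 - 1)} (hc : c ∈ hValues q)
    {r : ℤ} (hr : IsCoprime r (q : ℤ)) (n : ℕ) :
    c - n * (q * (numS r ((q : ℤ) ^ 2) : ZMod (q ^ 2 - 1))) ∈ hValues q := by
  induction n with
  | zero => simpa using hc
  | succ n ih =>
    have := sub_mem_hValues hq ih hr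
    push_cast
    convert this using 1
    ring

/-! ### Finite checks, and equality of the three sets -/

/-- The number `r² (q² S(r, q²))` up to a multiple of `q² - 1`. -/
theorem sq_mul_numS_eq {q r : ℕ} (hq : 2 ≤ q) (hr : 0 < r) (hc : Nat.Coprime r q) :
    ∃ z : ℤ, (r : ℤ) ^ 2 * numS r ((q : ℤ) ^ 2) = r * (r - 1) * (r - 2) + 3 * r ^ 2 * (r - 1)
      - 12 * ((∑ j ∈ Finset.range r, j * (q ^ 2 * j % r) : ℕ) : ℤ) + ((q : ℤ) ^ 2 - 1) * z := by
  have hr' : (0 : ℤ) < r := by exact_mod_cast hr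
  have hq' : (0 : ℤ) < (q : ℤ) ^ 2 := by positivity
  have hcop : IsCoprime (r : ℤ) ((q : ℤ) ^ 2) := (Nat.isCoprime_iff_coprime.2 hc).pow_right
  -- Reciprocity trades a sum of q² terms for one of r terms, and q² ≡ 1 simplifies the rest; this
  -- makes the check over q feasible.
  have h1 := numS_reciprocity hr' hq' hcop
  have h2 := cast_numS hr' hcop.symm
  have h3 := S_natCast_eq_sum_mod hr (h := q ^ 2) (Nat.Coprime.pow_left 2 hc.symm)
  have hP : ∑ j ∈ Finset.range r, (j : ℚ) * ((q ^ 2 * j % r : ℕ) : ℚ) =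
      ((∑ j ∈ Finset.range r, j * (q ^ 2 * j % r) : ℕ) : ℚ) := by push_cast; rfl
  rw [hP] at h3
  generalize ∑ j ∈ Finset.range r, j * (q ^ 2 * j % r) = P at h3 ⊢
  have h4 : (r : ℤ) * numS ((q : ℤ) ^ 2) r = 12 * P - 3 * r ^ 2 * (r - 1) := by
    have : ((r * numS ((q : ℤ) ^ 2) r : ℤ) : ℚ) = ((12 * P - 3 * r ^ 2 * (r - 1) : ℤ) : ℚ) := by
      rw [Int.cast_mul, h2]
      push_cast at h3 ⊢
      linear_combination h3
    exact_mod_cast this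
  refine ⟨-3 * r ^ 2 + r * ((q : ℤ) ^ 2 + 1) - r * numS ((q : ℤ) ^ 2) r, ?_⟩
  linear_combination (r : ℤ) * h1 - h4

/-- Some `r < 60` prime to `q` for which `q² S(r, q²)` generates the multiples of `24` modulo
`q² - 1`. -/
theorem exists_generator : ∀ q < 201, 2 ≤ q → ∃ r < 60, 0 < r ∧ Nat.gcd r q = 1 ∧
    Int.gcd ((r : ℤ) * (r - 1) * (r - 2) + 3 * r ^ 2 * (r - 1)
      - 12 * ((∑ j ∈ Finset.range r, j * (q ^ 2 * j % r) : ℕ) : ℤ)) ((q : ℤ) ^ 2 - 1) ∣ 24 := by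
  decide +kernel

theorem add_mul_mem_hValues {q : ℕ} (hq : 2 ≤ q) (hq' : q ≤ 200) {c : ZMod (q ^ 2 - 1)}
    (hc : c ∈ hValues q) (s : ZMod (q ^ 2 - 1)) : c + 24 * s ∈ hValues q := by
  obtain ⟨r, -, hr, hcop, hg⟩ := exists_generator q (by omega) hq
  obtain ⟨z, hz⟩ := sq_mul_numS_eq hq hr hcop
  have hg' : ((Int.gcd ((r : ℤ) * (r - 1) * (r - 2) + 3 * r ^ 2 * (r - 1)
      - 12 * ((∑ j ∈ Finset.range r, j * (q ^ 2 * j % r) : ℕ) : ℤ)) ((q : ℤ) ^ 2 - 1) : ℕ) : ℤ)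
      ∣ 24 := by exact_mod_cast hg
  obtain ⟨w, hw⟩ := hg'
  rw [Int.gcd_eq_gcd_ab] at hw
  generalize Int.gcdA _ _ = A at hw
  generalize Int.gcdB _ _ = B at hw
  generalize ((∑ j ∈ Finset.range r, j * (q ^ 2 * j % r) : ℕ) : ℤ) = P at hw hz
  have e1 := congrArg (Int.cast : ℤ → ZMod (q ^ 2 - 1)) hz
  have e2 := congrArg (Int.cast : ℤ → ZMod (q ^ 2 - 1)) hw
  have hq1 := sq_cast_eq_one hq
  push_cast at e1 e2
  have : NeZero (q ^ 2 - 1) := ⟨by have : 2 ^ 2 ≤ q ^ 2 := Nat.pow_le_pow_left hq 2; omega⟩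
  -- By Bézout 24 is a multiple of r² `numS r (q ^ 2)`. Since ℤ/(q² - 1) is finite, a natural number
  -- of subtractions realises any multiple, with either sign.
  obtain ⟨n, hn⟩ : ∃ n : ℕ, (n : ZMod (q ^ 2 - 1)) = -(q * r ^ 2 * A * w * s) :=
    ⟨_, ZMod.natCast_zmod_val _⟩
  convert sub_nsmul_mem_hValues hq hc (Nat.isCoprime_iff_coprime.2 hcop) n using 1
  rw [hn]
  generalize (numS (r : ℤ) ((q : ℤ) ^ 2) : ZMod (q ^ 2 - 1)) = N at e1 ⊢
  linear_combination s * e2 - s * A * w * e1 + (s * w * B - s * A * w * z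
    - r ^ 2 * A * w * s * N) * hq1

/-- Each entry is a prime p ≡ 1 modulo 4 with x, y such that p = x² + y². By quadratic reciprocity,
q being a nonresidue modulo p makes the symbol of x² + y² modulo q equal to -1. The bound 15
suffices because 15² > 200. -/
theorem exists_nonresidue : ∀ q < 201, q % 2 = 1 → (∀ m < 15, m * m ≠ q) →
    ∃ p ∈ [(5, 1, 2), (13, 2, 3), (17, 1, 4), (29, 2, 5), (37, 1, 6)],
      ∀ s < p.1, s * s % p.1 ≠ q % p.1 := by
  decide +kernel

theorem exists_hPair_jacobiSym {q : ℕ} (hq' : q ≤ 200) (hodd : Odd q) (hs : ¬ IsSquare q) :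
    ∃ x y : ℤ, HPair q x y ∧ jacobiSym (x ^ 2 + y ^ 2) q ≠ 1 := by
  obtain ⟨⟨p, x, y⟩, hp, hr⟩ := exists_nonresidue q (by omega) (Nat.odd_iff.1 hodd)
    fun m _ h => hs ⟨m, h.symm⟩
  have hp' : p.Prime ∧ p % 4 = 1 ∧ x ^ 2 + y ^ 2 = p ∧ IsCoprime (x : ℤ) y := by
    simp only [List.mem_cons, Prod.mk.injEq, List.not_mem_nil, or_false] at hp
    rcases hp with ⟨rfl, rfl, rfl⟩ | ⟨rfl, rfl, rfl⟩ | ⟨rfl, rfl, rfl⟩ | ⟨rfl, rfl, rfl⟩ |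
      ⟨rfl, rfl, rfl⟩ <;>
      exact ⟨by norm_num, rfl, rfl, Nat.isCoprime_iff_coprime.2 (by norm_num)⟩
  obtain ⟨hprime, hp4, hxy, hcxy⟩ := hp'
  have hxy' : (x : ℤ) ^ 2 + (y : ℤ) ^ 2 = p := by exact_mod_cast hxy
  have : Fact p.Prime := ⟨hprime⟩
  have hns : ¬ IsSquare ((q : ℤ) : ZMod p) := by
    rintro ⟨s, hsq⟩
    apply hr s.val (ZMod.val_lt s)
    have : ((s.val * s.val : ℕ) : ZMod p) = (q : ZMod p) := by
      push_cast
      rw [ZMod.natCast_zmod_val, ← hsq]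
      simp
    exact (ZMod.natCast_eq_natCast_iff' _ _ _).1 this
  have hleg : jacobiSym (p : ℤ) q = -1 := by
    rw [jacobiSym.quadratic_reciprocity_one_mod_four hp4 hodd, ← jacobiSym.legendreSym.to_jacobiSym]
    exact (legendreSym.eq_neg_one_iff p).2 hns
  refine ⟨x, y, ⟨hcxy, ?_⟩, ?_⟩
  · rw [hxy', Nat.isCoprime_iff_coprime, Nat.Prime.coprime_iff_not_dvd hprime]
    intro hd
    apply hns
    have : (q : ZMod p) = 0 := (ZMod.natCast_eq_zero_iff _ _).2 hd
    exact ⟨0, by simp [this]⟩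
  · rw [hxy', hleg]
    norm_num

theorem GammaSet_subset_hValues {q : ℕ} (hq : 2 ≤ q) (hq' : q ≤ 200) :
    GammaSet q ⊆ hValues q := by
  have hq1 := sq_cast_eq_one hq
  rintro c (⟨-, s, rfl⟩ | ⟨hs, s, rfl⟩)
  · simpa using add_mul_mem_hValues hq hq' (zero_mem_hValues hq) s
  · rcases Nat.even_or_odd q with he | ho
    · obtain ⟨m, hm⟩ := he
      -- With q = 2m, 24 · mqs = 12q²s = 12s.
      have := add_mul_mem_hValues hq hq' (zero_mem_hValues hq) (m * q * s)
      have hm' : (q : ZMod (q ^ 2 - 1)) = m + m := by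
        rw [← Nat.cast_add, ← hm]
      convert this using 1
      linear_combination (-12 * s) * hq1 + 12 * s * q * hm'
    · obtain ⟨x, y, h, hJ⟩ := exists_hPair_jacobiSym hq' ho hs
      obtain ⟨y', hy'⟩ := h.exists_inv
      have ha : y * (x * y') ≡ x [ZMOD x ^ 2 + y ^ 2] := by
        have := hy'.mul_left x
        rwa [mul_one, ← mul_assoc, mul_comm x, mul_assoc] at this
      have hL := h.lamPair ha
      have hc := h.hasH hq ha
      have h4 := (hL.numLam_mod_eight ho).1
      have h8 : ¬ 8 ∣ numLam q (x * y') (x ^ 2 + y ^ 2) := fun h8 =>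
        hJ ((hL.numLam_mod_eight ho).2.1 h8)
      have h3 := hL.three_dvd
      generalize numLam q (x * y') (x ^ 2 + y ^ 2) = L at h4 h8 h3 hc
      have d3 : (3 : ℤ) ∣ L * q ^ 2 := by
        by_cases h : 3 ∣ q
        · have : (3 : ℤ) ∣ q := by exact_mod_cast h
          exact (this.pow two_ne_zero).mul_left _
        · exact (h3 h).mul_right _
      have d4 : (4 : ℤ) ∣ L * q ^ 2 := h4.mul_right _
      have d8 : ¬ (8 : ℤ) ∣ L * q ^ 2 := by
        intro h
        have ho' : Odd ((q : ℤ) ^ 2) := by exact_mod_cast ho.pow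
        rw [mul_comm] at h
        exact h8 (dvd_of_dvd_odd_mul 3 ho' h)
      obtain ⟨l, hl⟩ : (12 : ℤ) ∣ L * q ^ 2 := by omega
      have hmem : (L : ZMod (q ^ 2 - 1)) ∈ hValues q := ⟨x, y, h, hc⟩
      have hl' := congrArg (Int.cast : ℤ → ZMod (q ^ 2 - 1)) hl
      push_cast at hl'
      obtain ⟨n, rfl⟩ := ZMod.intCast_surjective s
      -- Even multiples of 12 are translates of 0. Odd ones are translates of L, whose class is 12l
      -- with l odd because 8 ∤ L.
      rcases Int.even_or_odd' n with ⟨k, rfl | rfl⟩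
      · have := add_mul_mem_hValues hq hq' (zero_mem_hValues hq) k
        convert this using 1
        push_cast
        ring
      · obtain ⟨k', rfl⟩ : ∃ k', l = 2 * k' + 1 := ⟨l / 2, by omega⟩
        have := add_mul_mem_hValues hq hq' hmem (k - k')
        convert this using 1
        push_cast at hl' ⊢
        linear_combination -hl' + L * hq1

theorem hValues_eq_GammaSet {q : ℕ} (hq : 2 ≤ q) (hq' : q ≤ 200) : hValues q = GammaSet q :=
  Set.Subset.antisymm (hValues_subset_LambdaSet.trans (LambdaSet_subset_GammaSet hq))
    (GammaSet_subset_hValues hq hq')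

theorem LambdaSet_eq_GammaSet {q : ℕ} (hq : 2 ≤ q) (hq' : q ≤ 200) :
    LambdaSet q = GammaSet q :=
  Set.Subset.antisymm (LambdaSet_subset_GammaSet hq)
    ((GammaSet_subset_hValues hq hq').trans hValues_subset_LambdaSet)

/-! ### Which k/q are values of `S` -/

/-- The value `k / q` is attained if the class of `k - q S(k, q)` lies in `Λ_q`. -/
theorem exists_S_eq_of_mem_LambdaSet {q : ℕ} (hq : 2 ≤ q) {k : ℤ} (hk : IsCoprime k (q : ℤ))
    (h : ((k - numS k q : ℤ) : ZMod (q ^ 2 - 1)) ∈ LambdaSet q) :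
    ∃ a b : ℤ, 1 ≤ b ∧ IsCoprime a b ∧ S a b = (k : ℚ) / q := by
  obtain ⟨a₀, t', h0, n, hn, hnc⟩ := h
  have hq0 : (0 : ℤ) < q := by exact_mod_cast (by omega : 0 < q)
  have hn' : numLam q a₀ t' = n := by
    have := h0.cast_numLam
    rw [← hn] at this
    exact_mod_cast this
  obtain ⟨j, hj⟩ := ((ZMod.intCast_eq_intCast_iff _ _ _).1 hnc).dvd
  rw [Nat.cast_sub (Nat.one_le_pow _ _ (by omega))] at hj
  push_cast at hj
  -- Shifting a₀ by a multiple of t' upgrades the congruence modulo q² - 1 to an equality of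
  -- integers.
  obtain ⟨h1, e1⟩ := h0.add_mul j
  generalize a₀ + t' * j = A at h1 e1
  have hκ : numLam q A t' = k - numS k q := by rw [e1, hn']; linear_combination -hj
  obtain ⟨l, hl⟩ := (mul_numS_modEq hq0 hk).dvd
  have h2 := h1.mul_numLam
  have ht' := h1.1
  have hcq : IsCoprime t' (q : ℤ) := h1.isCoprime.2.symm
  -- Modulo q, t'λ ≡ -A, while kλ = k² - k · `numS k q` ≡ -1. So r = k is admissible in `mul_S_eq`.
  have hkA : k * A ≡ t' [ZMOD q] := Int.modEq_iff_dvd.2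
    ⟨-k * (q * A - numS (A * q) t') + t' * l, by rw [hκ] at h2; linear_combination t' * hl - k * h2⟩
  have hcA : IsCoprime A (q : ℤ) := (IsCoprime.of_modEq hkA.symm hcq).of_mul_left_right
  have hA : A ≠ 0 := by
    rintro rfl
    rw [isCoprime_zero_left, Int.isUnit_iff] at hcA
    omega
  obtain ⟨t, ht⟩ := h1.2.1
  have htpos : 0 < t := pos_of_mul_pos_right (by rw [← ht]; positivity) ht'.le
  have h3 := mul_S_eq (by omega) hA htpos ht' (by rw [ht]; ring) hcA hcq hkA
  have hS := cast_numS hq0 hk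
  have hq0' : (q : ℚ) ≠ 0 := by exact_mod_cast hq0.ne'
  refine ⟨A, q * t, by have := mul_pos hq0 htpos; omega,
    hcA.mul_right ⟨-A, t', by linear_combination -ht⟩, ?_⟩
  rw [← h1.cast_numLam, hκ] at h3
  push_cast at h3 hS
  field_simp
  linear_combination h3 - hS

/-- The local conditions match `numS k q`: for odd q it is q + 1 - 2(k/q) modulo 8, with (k/q) the
Jacobi symbol. This is 2 modulo 4 if q ≡ 3 modulo 4, 0 modulo 4 if q ≡ 1, and 0 modulo 8 if q is a
square. -/
theorem LocalConditions.mem_GammaSet {q : ℕ} (hq : 2 ≤ q) {k : ℤ} (hk : IsCoprime k (q : ℤ))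
    (h : LocalConditions k q) : ((k - numS k q : ℤ) : ZMod (q ^ 2 - 1)) ∈ GammaSet q := by
  have hq0 : (0 : ℤ) < q := by exact_mod_cast (by omega : 0 < q)
  have hsq : Odd q → IsSquare q → q % 8 = 1 := by
    rintro ho ⟨m, rfl⟩
    obtain ⟨z, hz⟩ := eight_dvd_sq_sub_one (q := m)
      (by exact_mod_cast (Nat.odd_mul.1 ho).1)
    have : (m : ℤ) * m = 8 * z + 1 := by linear_combination hz
    omega
  apply intCast_mem_GammaSet hq
  · intro h3
    exact dvd_sub (h.1 h3) (three_dvd_numS hq0 hk (by exact_mod_cast h3))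
  · intro ho
    obtain ⟨c1, c2, c3⟩ := h.2 (by rw [Nat.two_dvd_ne_zero]; exact Nat.odd_iff.1 ho)
    have h8 := numS_mod_eight q ho k hk
    have ho' := Nat.odd_iff.1 ho
    unfold Int.ModEq at *
    unfold Nat.ModEq at *
    by_cases hs : IsSquare q
    · have := c2 hs
      have := hsq ho hs
      rcases jacobiSym_eq_one_or hk with e | e <;> rw [e] at h8 <;> omega
    · by_cases h4 : q % 4 = 3 % 4
      · have := c1 h4
        rcases jacobiSym_eq_one_or hk with e | e <;> rw [e] at h8 <;> omega
      · have := c3 h4 hs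
        rcases jacobiSym_eq_one_or hk with e | e <;> rw [e] at h8 <;> omega
  · intro ho hs
    have c2 := (h.2 (by rw [Nat.two_dvd_ne_zero]; exact Nat.odd_iff.1 ho)).2.1 hs
    have h8 := numS_mod_eight q ho k hk
    have := hsq ho hs
    rw [jacobiSym_of_isSquare hs (by omega) hk] at h8
    unfold Int.ModEq at *
    omega

/-- Reciprocity for (a, qt), divided by t, expresses ak through t' and `numS (q * t) a`. Both are
known modulo 8, and q² ≡ 1 there. -/
theorem mul_modEq_of_S_eq_div {q a : ℕ} (hq : Odd q) (ha : Odd a) {t t' k : ℤ} (ht : 0 < t)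
    (htt' : t * t' = (a : ℤ) ^ 2 + 1) (hc : IsCoprime (a : ℤ) q)
    (h : numS a (q * t) = k * t) :
    a * k ≡ 1 - q - 2 * jacobiSym t a + 2 * q * (jacobiSym q a * jacobiSym t a) [ZMOD 8] := by
  have hq0 : (0 : ℤ) < q := by exact_mod_cast hq.pos
  have ha0 : (0 : ℤ) < a := by exact_mod_cast ha.pos
  have c1 : IsCoprime (a : ℤ) t := ⟨-a, t', by linear_combination htt'⟩
  have h1 := numS_reciprocity ha0 (mul_pos hq0 ht) (hc.mul_right c1)
  have h2 : a * k + q * numS (q * t) a = -3 * (a * q) + q ^ 2 * t + t' := by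
    apply mul_left_cancel₀ ht.ne'
    rw [h] at h1
    linear_combination h1 - htt'
  have h3 := numS_mod_eight a ha (q * t) (hc.mul_right c1).symm
  rw [jacobiSym.mul_left] at h3
  have h5 := add_modEq_five_sub_jacobiSym ha ht htt'
  have h6 := h3.mul_left (q : ℤ)
  obtain ⟨w, hw⟩ := eight_dvd_sq_sub_one (q := (q : ℤ)) (by exact_mod_cast hq)
  have h7 : (q : ℤ) ^ 2 * t = t + 8 * (w * t) := by linear_combination t * hw
  obtain ⟨m, hm⟩ := ha.mul hq
  have hm' : (a : ℤ) * q = 2 * m + 1 := by exact_mod_cast hm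
  rw [h7, hm'] at h2
  have h8 : (q : ℤ) * (a + 1 - 2 * (jacobiSym q a * jacobiSym t a)) =
      2 * m + 1 + q - 2 * q * (jacobiSym q a * jacobiSym t a) := by
    linear_combination hm'
  rw [h8] at h6
  generalize (2 * q * (jacobiSym q a * jacobiSym t a) : ℤ) = J at h6 ⊢
  unfold Int.ModEq at *
  omega

theorem localConditions_of_S_eq {q : ℕ} (hq : 2 ≤ q) {k : ℤ} (hk : IsCoprime k (q : ℤ))
    {a b : ℤ} (hb : 1 ≤ b) (hab : IsCoprime a b) (h : S a b = (k : ℚ) / q) :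
    LocalConditions k q := by
  have hq0 : (0 : ℤ) < q := by exact_mod_cast (by omega : 0 < q)
  have hb0 : 0 < b := by omega
  have hS := cast_numS hb0 hab
  have e1 : q * numS a b = k * b := by
    have hq0' : (q : ℚ) ≠ 0 := by exact_mod_cast hq0.ne'
    have : ((q * numS a b : ℤ) : ℚ) = ((k * b : ℤ) : ℚ) := by
      push_cast
      rw [hS, h]
      field_simp
    exact_mod_cast this
  obtain ⟨t, rfl⟩ : (q : ℤ) ∣ b := hk.symm.dvd_of_dvd_mul_left ⟨_, e1.symm⟩
  have htpos : 0 < t := pos_of_mul_pos_right hb0 hq0.le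
  have e2 : numS a (q * t) = k * t := by
    apply mul_left_cancel₀ hq0.ne'
    linear_combination e1
  -- Here `numS` equals kt, a multiple of t, and a · `numS` ≡ a² + 1 modulo qt.
  have hta : t ∣ a ^ 2 + 1 := by
    obtain ⟨m, hm⟩ := (mul_numS_modEq hb0 hab).dvd
    exact ⟨q * m + a * k, by rw [e2] at hm; linear_combination hm⟩
  have h3t := not_three_dvd_of_dvd_sq_add_one hta
  refine ⟨fun h3 => ?_, fun h2 => ?_⟩
  · have h3q : ¬ (3 : ℤ) ∣ q := by exact_mod_cast h3
    have := three_dvd_numS hb0 hab fun hd =>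
      (Int.prime_three.dvd_or_dvd hd).elim h3q h3t
    rw [e2] at this
    exact (Int.prime_three.dvd_or_dvd this).resolve_right h3t
  · have ho : Odd q := Nat.odd_iff.2 (Nat.two_dvd_ne_zero.1 h2)
    have hoz : Odd (q : ℤ) := by exact_mod_cast ho
    have heven : Even ((q : ℤ) * t) → Odd a := by
      intro he
      rcases Int.even_mul.1 he with h' | h'
      · exact absurd hoz (Int.not_odd_iff_even.2 h')
      · exact odd_of_dvd_sq_add_one hta h'
    obtain ⟨j, n, hn, hodd⟩ := exists_odd_pos_add_mul hb0 heven
    have hmod : a ≡ n [ZMOD q * t] := Int.modEq_iff_dvd.2 ⟨j, by rw [hn]; ring⟩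
    rw [numS_congr hmod] at e2
    have hcn := IsCoprime.of_modEq hmod hab
    obtain ⟨t', ht'⟩ : t ∣ (n : ℤ) ^ 2 + 1 := by
      rw [hn, show (a + q * t * j) ^ 2 + 1 = (a ^ 2 + 1) + t * (2 * a * q * j + q ^ 2 * t * j ^ 2)
        by ring]
      exact dvd_add hta (dvd_mul_right _ _)
    have hcq := (IsCoprime.mul_right_iff.1 hcn).1
    have key := mul_modEq_of_S_eq_div ho hodd htpos ht'.symm hcq e2
    have hn' : Odd (n : ℤ) := by exact_mod_cast hodd
    have hJ1 := jacobiSym_eq_one_or (IsCoprime.mul_right_iff.1 hcn).2.symm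
    have hJ2 := jacobiSym_eq_one_or hcq.symm
    unfold Int.ModEq Nat.ModEq at *
    refine ⟨fun h4 => ?_, fun hs => ?_, fun h4 _ => ?_⟩
    · have h5 : (n * k) % 4 = 2 := by
        rcases hJ1 with e | e <;> rcases hJ2 with e' | e' <;> rw [e, e'] at key <;> omega
      obtain ⟨l, hl⟩ := dvd_of_dvd_odd_mul (x := k) 1 hn' (by omega)
      have : ¬ (2 : ℤ) ∣ l := by
        rintro ⟨l', rfl⟩
        rw [show (n : ℤ) * k = 4 * (n * l') by rw [hl]; ring] at h5
        omega
      omega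
    · have hJ2' : jacobiSym q n = 1 := by
        obtain ⟨m, rfl⟩ := hs
        push_cast
        rw [jacobiSym.mul_left]
        push_cast at hcq
        rcases jacobiSym_eq_one_or (IsCoprime.mul_right_iff.1 hcq).1.symm with e | e <;>
          rw [e] <;> rfl
      have hq8 : (q : ℤ) % 8 = 1 := by
        obtain ⟨m, rfl⟩ := hs
        obtain ⟨z, hz⟩ := eight_dvd_sq_sub_one (q := m)
          (by exact_mod_cast (Nat.odd_mul.1 ho).1)
        push_cast
        rw [show (m : ℤ) * m = 8 * z + 1 by linear_combination hz]
        omega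
      have h5 : (8 : ℤ) ∣ n * k := by
        rcases hJ1 with e | e <;> rw [e, hJ2'] at key <;> omega
      have := dvd_of_dvd_odd_mul 3 hn' h5
      omega
    · have ho' := Nat.odd_iff.1 ho
      have h5 : (4 : ℤ) ∣ n * k := by
        rcases hJ1 with e | e <;> rcases hJ2 with e' | e' <;> rw [e, e'] at key <;> omega
      have := dvd_of_dvd_odd_mul 2 hn' h5
      omega

end DedekindRange

/-- For `2 ≤ q ≤ 200`: the quantities reduced modulo `q² - 1` are integers and `h(x, y)` is well
defined; the set of values of `h` is `Γ_q`; `Λ_q = Γ_q`; and the values `k / q` (in lowest terms)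
of normalized Dedekind sums are exactly those satisfying the local conditions. -/
theorem mainTheorem3 (q : ℕ) (hq2 : 2 ≤ q) (hq200 : q ≤ 200) :
    (∀ x y : ℤ, DedekindRange.HPair q x y → ∃! c, DedekindRange.HasH q x y c) ∧
    {c | ∃ x y : ℤ, DedekindRange.HPair q x y ∧ DedekindRange.HasH q x y c} =
      DedekindRange.GammaSet q ∧
    (∀ a t : ℤ, DedekindRange.LamPair q a t → ∃ n : ℤ, (n : ℚ) = DedekindRange.lam q a t) ∧
    DedekindRange.LambdaSet q = DedekindRange.GammaSet q ∧
    (∀ k : ℤ, IsCoprime k (q : ℤ) →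
      ((∃ a b : ℤ, 1 ≤ b ∧ IsCoprime a b ∧ DedekindRange.S a b = (k : ℚ) / q) ↔
        DedekindRange.LocalConditions k q)) := by
  refine ⟨fun x y h => h.existsUnique_hasH hq2, DedekindRange.hValues_eq_GammaSet hq2 hq200,
    fun a t h => h.exists_eq, DedekindRange.LambdaSet_eq_GammaSet hq2 hq200, fun k hk => ⟨?_, ?_⟩⟩
  · rintro ⟨a, b, hb, hab, h⟩
    exact DedekindRange.localConditions_of_S_eq hq2 hk hb hab h
  · intro h
    apply DedekindRange.exists_S_eq_of_mem_LambdaSet hq2 hk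
    rw [DedekindRange.LambdaSet_eq_GammaSet hq2 hq200]
    exact h.mem_GammaSet hq2 hk
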